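/- Let $L,r,R_1>0$ and $G,R_2\in\mathbb R$. There is a constant $C>0$, depending only on $L,G,r,R_1,R_2$, such that the following holds for all $d\ge 1$, $T\ge 2$ and $B_T,S_T\ge 0$. Let $\Omega\subseteq\mathbb R^d$ be closed and convex with $R_1\mathbb B\subseteq\Omega\subseteq R_2\mathbb B$, where $\mathbb B$ is the closed Euclidean unit ball. Let $f_1,\dots,f_T:\mathbb R^d\to\mathbb R$ be (deterministic) loss functions that are on $\Omega$ convex, $G$-Lipschitz and $L$-smooth (differentiable with $L$-Lipschitz gradient), let $f_0$ be any function differentiable on $\Omega$ (for example $f_0=0$), and let $\Omega_t^*$ be the set of minimizers of $f_t$ over $\Omega$. Assume $\|w-w^*\|_2\le r$ for all $w\in\Omega$, $w^*\in\Omega_t^*$, $1\le t\le T$, and $$V^p_T=\max_{w_t^*\in\Omega_t^*}\sum_{t=1}^{T-1}\|w_t^*-w_{t+1}^*\|_2\le B_T,\qquad V^g_T=\sum_{t=1}^{T}\sup_{w\in\Omega}\|\nabla f_t(w)-\nabla f_{t-1}(w)\|_2^2\le S_T .$$ Consider the two-point bandit META algorithm with $\xi=1/T$, $\delta=\xi R_1$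 and step size $\eta>0$: start with $w_1=\hat w_1=0$, $\hat g_0=0$; in round $t=1,\dots,T$ draw $i_t$ uniformly from $\{1,\dots,d\}$, independently of the past, submit $\hat w_t^1=\hat w_t+\delta e_{i_t}$ and $\hat w_t^2=\hat w_t-\delta e_{i_t}$, set $v_t=\frac1{2\delta}\bigl(f_t(\hat w^1_t)-f_t(\hat w^2_t)\bigr)$, $$g_t=d\,(v_t-\hat g_{t-1,i_t})e_{i_t}+\hat g_{t-1},\qquad \hat g_t=(v_t-\hat g_{t-1,i_t})e_{i_t}+\hat g_{t-1},$$ $$w_{t+1}=\Pi_{(1-\xi)\Omega}[w_t-\eta g_t],\qquad \hat w_{t+1}=\Pi_{(1-\xi)\Omega}[w_{t+1}-\eta\hat g_t],$$ where $\Pi_K$ is the Euclidean projection onto $K$. Let $w_t^*\in\Omega_t^*$ and $$\mathcal R_T=\mathrm E\Bigl[\sum_{t=1}^T\tfrac12\bigl(f_t(\hat w_t^1)+f_t(\hat w_t^2)\bigr)\Bigr]-\sum_{t=1}^Tf_t(w_t^*).$$ Then (with $\sqrt{a/0}=+\infty$ for $a>0$): 1. if $\eta=\min\Bigl(\sqrt{\frac{2rB_T+r^2}{8S_Td^4}},\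 \frac1{16Ld^{3/2}}\Bigr)$, then $$\mathcal R_T\le C\max\bigl\{d^2\sqrt{S_T\max(B_T,1)},\ d^{3/2}\max(B_T,1)\bigr\};$$ 2. if $\eta=\min\Bigl(\sqrt{\frac{2rB_T+r^2}{8S_Td^4}},\ \frac1{4Ld^{3/2}\sqrt{\ln T}}\Bigr)$, then $$\mathcal R_T\le C\max\bigl\{d^2\sqrt{S_T\max(B_T,1)},\ d^{3/2}\sqrt{\ln T}\,\max(B_T,1)\bigr\}.$$ -/

import Mathlib

open MeasureTheory ProbabilityTheory
open scoped NNReal ENNReal Pointwise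

namespace BanditOCO

/-- The decision space `ℝ^d` with the Euclidean norm. -/
abbrev E (d : ℕ) : Type := EuclideanSpace ℝ (Fin d)

/-- `y` is a Euclidean projection of `x` onto `K`. -/
def IsProj {d : ℕ} (K : Set (E d)) (x y : E d) : Prop :=
  y ∈ K ∧ ∀ z ∈ K, ‖x - y‖ ≤ ‖x - z‖

/-- The Euclidean projection `Π_K[x]`; for nonempty closed convex `K` it is the unique nearest
point of `K` (existence: `isProj_proj`). -/
noncomputable def proj {d : ℕ} (K : Set (E d)) (x : E d) : E d :=
  Classical.epsilon (IsProj K x)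

theorem isProj_proj {d : ℕ} {K : Set (E d)} (hK : IsClosed K) (hne : K.Nonempty) (x : E d) :
    IsProj K x (proj K x) := by
  apply Classical.epsilon_spec
  obtain ⟨y, hy, h⟩ := hK.exists_infDist_eq_dist hne x
  refine ⟨y, hy, fun z hz => ?_⟩
  rw [← dist_eq_norm, ← dist_eq_norm, ← h]
  exact Metric.infDist_le_dist_of_mem hz

/-- The set of minimizers of `f` over `Ω`. -/
def minimizers {d : ℕ} (Ω : Set (E d)) (f : E d → ℝ) : Set (E d) :=
  {w | w ∈ Ω ∧ IsMinOn f Ω w}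

/-- `f` is `L`-smooth on `Ω`: differentiable with `L`-Lipschitz gradient. On a convex set with
interior points the gradient within `Ω` is unique, and it is the ordinary gradient wherever `f`
is differentiable on the whole space. -/
def SmoothOn {d : ℕ} (L : ℝ) (Ω : Set (E d)) (f : E d → ℝ) : Prop :=
  DifferentiableOn ℝ f Ω ∧
    ∀ w ∈ Ω, ∀ w' ∈ Ω, ‖gradientWithin f Ω w - gradientWithin f Ω w'‖ ≤ L * ‖w - w'‖

/-- Path variation: the largest value of `∑_{t=1}^{T-1} ‖w*_t - w*_{t+1}‖` over all choices of
minimizers `w*_t` of `f_t` on `Ω`. -/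
noncomputable def pathVariation {d : ℕ} (Ω : Set (E d)) (f : ℕ → E d → ℝ) (T : ℕ) : ℝ≥0∞ :=
  ⨆ (w : ℕ → E d) (_ : ∀ t ∈ Finset.Icc 1 T, w t ∈ minimizers Ω (f t)),
    ∑ t ∈ Finset.Ico 1 T, ‖w t - w (t + 1)‖ₑ

/-- Gradient variation: `∑_{t=1}^T sup_{w ∈ Ω} ‖∇f_t(w) - ∇f_{t-1}(w)‖²`. -/
noncomputable def gradientVariation {d : ℕ} (Ω : Set (E d)) (f : ℕ → E d → ℝ) (T : ℕ) : ℝ≥0∞ :=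
  ∑ t ∈ Finset.Icc 1 T,
    ⨆ w ∈ Ω, ‖gradientWithin (f t) Ω w - gradientWithin (f (t - 1)) Ω w‖ₑ ^ 2

/-- What the algorithm carries into round `t`: the points `w_t`, `ŵ_t` and the gradient
estimate `ĝ_{t-1}`. -/
structure MetaState (d : ℕ) where
  w : E d
  wHat : E d
  gHat : E d

/-- The two points submitted in a round whose random coordinate is `i`. -/
noncomputable def queryPlus {d : ℕ} (δ : ℝ) (s : MetaState d) (i : Fin d) : E d :=
  s.wHat + δ • EuclideanSpace.single i (1 : ℝ)

noncomputable def queryMinus {d : ℕ} (δ : ℝ) (s : MetaState d) (i : Fin d) : E d :=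
  s.wHat - δ • EuclideanSpace.single i (1 : ℝ)

/-- One round of META on the loss `f` with random coordinate `i`; `K` is the shrunken domain
onto which the iterates are projected. -/
noncomputable def metaStep {d : ℕ} (K : Set (E d)) (δ η : ℝ) (f : E d → ℝ) (i : Fin d)
    (s : MetaState d) : MetaState d :=
  let v : ℝ := (f (queryPlus δ s i) - f (queryMinus δ s i)) / (2 * δ)
  let g : E d := ((d : ℝ) * (v - s.gHat i)) • EuclideanSpace.single i (1 : ℝ) + s.gHat
  let gHat' : E d := (v - s.gHat i) • EuclideanSpace.single i (1 : ℝ) + s.gHat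
  let w' : E d := proj K (s.w - η • g)
  { w := w'
    wHat := proj K (w' - η • gHat')
    gHat := gHat' }

/-- The state after `n` rounds, on the losses `f 1, f 2, …` with random coordinates
`i 1, i 2, …`; that is, `(w_{n+1}, ŵ_{n+1}, ĝ_n)`. -/
noncomputable def metaRun {d : ℕ} (K : Set (E d)) (δ η : ℝ) (f : ℕ → E d → ℝ) (i : ℕ → Fin d) :
    ℕ → MetaState d
  | 0 => { w := 0, wHat := 0, gHat := 0 }
  | n + 1 => metaStep K δ η (f (n + 1)) (i (n + 1)) (metaRun K δ η f i n)

/-- Total loss of META over `T` rounds, averaged over the two submitted points of each round,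
with `ξ = 1/T` and `δ = ξ R₁`. -/
noncomputable def metaLoss {d : ℕ} (Ω : Set (E d)) (R₁ η : ℝ) (T : ℕ) (f : ℕ → E d → ℝ)
    (i : ℕ → Fin d) : ℝ :=
  let ξ : ℝ := 1 / (T : ℝ)
  let δ : ℝ := ξ * R₁
  ∑ t ∈ Finset.Icc 1 T,
    (f t (queryPlus δ (metaRun ((1 - ξ) • Ω) δ η f i (t - 1)) (i t)) +
      f t (queryMinus δ (metaRun ((1 - ξ) • Ω) δ η f i (t - 1)) (i t))) / 2

/-- `min (√((2 r B + r²) / (8 S d⁴)), cap)`, where the first term is `+∞` if `S = 0`. -/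
noncomputable def stepSize (d : ℕ) (r B S cap : ℝ) : ℝ :=
  if S = 0 then cap
  else min (Real.sqrt ((2 * r * B + r ^ 2) / (8 * S * (d : ℝ) ^ 4))) cap

/-- The random coordinates: independent and uniform on the `d` coordinates. -/
def IsUniformIID {d : ℕ} {P : Type*} [MeasurableSpace P] (μ : Measure P) (i : ℕ → P → Fin d) :
    Prop :=
  (∀ t, Measurable (i t)) ∧ iIndepFun i μ ∧ ∀ t k, μ (i t ⁻¹' {k}) = (d : ℝ≥0∞)⁻¹

end BanditOCO

/-!
Let `V` be the vector of difference quotients of the current loss at `ŵ`. It differs from the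
gradient there by `O(√d L δ)`, so `⟪V, ŵ - u⟫` bounds the regret of a round against `u` up to errors
that total `O(√d)`. Averaged over the random coordinate, the estimate `g` equals `V`, and the
passage from `w` through `ŵ` to the next `w` is an optimistic gradient step with prediction `ĝ`. Its
cost is governed by the prediction error `‖V - ĝ‖²`. Refreshing one random coordinate of `ĝ` shrinks
this error by the factor `1 - 1/d` on average, while the motion of `ŵ` and the change of the loss
enlarge it. Consequently the potential
`‖w - u‖² / (2η) + 2 η d² ‖V - ĝ‖² - ‖w - ŵ‖² / (4η)`
pays for the regret of a round on average, up to the path and gradient variation: once `η L d^{3/2}`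
is at most an absolute constant, the motion of `ŵ` is absorbed by the negative terms of the
optimistic step.

Scaling the comparators by `1 - 1/T` moves them into the shrunken domain at total cost `G r`. Two
cases escape the potential argument, `T < d` and, for the step size with the logarithm, `T ≤ e¹⁶`;
in both, the trivial bound, which is linear in `T`, is enough.
-/

namespace BanditOCO

variable {d : ℕ}

/-! ### Optimistic projected gradient steps -/

theorem IsProj.inner_le_zero {K : Set (E d)} (hK : Convex ℝ K) {x y z : E d}
    (h : IsProj K x y) (hz : z ∈ K) : inner ℝ (x - y) (z - y) ≤ 0 := by
  have : Nonempty K := ⟨⟨y, h.1⟩⟩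
  have hbdd : BddBelow (Set.range fun w : K => ‖x - w‖) :=
    ⟨0, Set.forall_mem_range.2 fun _ => norm_nonneg _⟩
  exact (norm_eq_iInf_iff_real_inner_le_zero hK h.1).1
    ((le_ciInf fun w : K => h.2 w.1 w.2).antisymm (ciInf_le hbdd ⟨y, h.1⟩)) z hz

section InnerProductSpace

variable {F : Type*} [NormedAddCommGroup F] [InnerProductSpace ℝ F]

theorem inner_le_mul_norm_sq_add_div (a b : F) {η : ℝ} (hη : 0 < η) :
    inner ℝ a b ≤ η * ‖a‖ ^ 2 + ‖b‖ ^ 2 / (4 * η) := by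
  have h_sq : 0 ≤ (2 * η * ‖a‖ - ‖b‖) ^ 2 / (4 * η) := by positivity
  have h_expand : (2 * η * ‖a‖ - ‖b‖) ^ 2 / (4 * η)
      = η * ‖a‖ ^ 2 + ‖b‖ ^ 2 / (4 * η) - ‖a‖ * ‖b‖ := by
    field_simp
    ring
  linarith [real_inner_le_norm a b]

theorem inner_gradient_step_le {x y z g : F} {η : ℝ} (hη : 0 < η)
    (h : inner ℝ (x - η • g - y) (z - y) ≤ 0) :
    inner ℝ g (y - z) ≤ (‖x - z‖ ^ 2 - ‖y - z‖ ^ 2 - ‖x - y‖ ^ 2) / (2 * η) := by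
  have h_split : inner ℝ (x - η • g - y) (z - y)
      = inner ℝ (x - y) (z - y) + η * inner ℝ g (y - z) := by
    rw [sub_right_comm, inner_sub_left, real_inner_smul_left, ← neg_sub y z, inner_neg_right g]
    ring
  have h_norm := norm_sub_sq_real (x - y) (z - y)
  rw [sub_sub_sub_cancel_right, norm_sub_rev z y] at h_norm
  rw [le_div_iff₀ (by positivity)]
  linarith

theorem inner_optimistic_step_le {w wHat w' u g gHat : F} {η : ℝ} (hη : 0 < η)
    (hw' : inner ℝ (w - η • g - w') (u - w') ≤ 0)
    (hwHat : inner ℝ (w - η • gHat - wHat) (w' - wHat) ≤ 0) :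
    inner ℝ g (wHat - u) ≤ (‖w - u‖ ^ 2 - ‖w' - u‖ ^ 2) / (2 * η) + η * ‖g - gHat‖ ^ 2
      - ‖wHat - w'‖ ^ 2 / (4 * η) - ‖w - wHat‖ ^ 2 / (2 * η) := by
  have h_split : inner ℝ g (wHat - u)
      = inner ℝ g (w' - u) + inner ℝ gHat (wHat - w') + inner ℝ (g - gHat) (wHat - w') := by
    rw [inner_sub_left, add_assoc, add_sub_cancel, ← inner_add_right, add_comm,
      sub_add_sub_cancel]
  have h_real := inner_gradient_step_le hη hw'
  have h_pred := inner_gradient_step_le hη hwHat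
  have h_young := inner_le_mul_norm_sq_add_div (g - gHat) (wHat - w') hη
  have h_sum : (‖w - u‖ ^ 2 - ‖w' - u‖ ^ 2 - ‖w - w'‖ ^ 2) / (2 * η)
      + (‖w - w'‖ ^ 2 - ‖wHat - w'‖ ^ 2 - ‖w - wHat‖ ^ 2) / (2 * η)
      + ‖wHat - w'‖ ^ 2 / (4 * η)
      = (‖w - u‖ ^ 2 - ‖w' - u‖ ^ 2) / (2 * η) - ‖wHat - w'‖ ^ 2 / (4 * η)
        - ‖w - wHat‖ ^ 2 / (2 * η) := by
    field_simp
    ring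
  linarith

end InnerProductSpace

section Seminormed

variable {F : Type*} [SeminormedAddCommGroup F]

theorem norm_sub_sq_le_of_norm_sub_le {r : ℝ} {w u u' : F} (h : ‖w - u‖ ≤ r) (h' : ‖w - u'‖ ≤ r) :
    ‖w - u'‖ ^ 2 ≤ ‖w - u‖ ^ 2 + 2 * r * ‖u - u'‖ := by
  have h_tri : ‖w - u'‖ ≤ ‖w - u‖ + ‖u - u'‖ := norm_sub_le_norm_sub_add_norm_sub _ _ _
  nlinarith [norm_nonneg (w - u), norm_nonneg (w - u'), norm_nonneg (u - u')]

theorem norm_add_sq_le_weighted (a b : F) {c : ℝ} (hc : 0 < c) :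
    ‖a + b‖ ^ 2 ≤ (1 + 1 / c) * ‖a‖ ^ 2 + (1 + c) * ‖b‖ ^ 2 := by
  have h_tri : ‖a + b‖ ^ 2 ≤ (‖a‖ + ‖b‖) ^ 2 := by gcongr; exact norm_add_le a b
  have h_sq : 0 ≤ (‖a‖ - c * ‖b‖) ^ 2 / c := by positivity
  have h_expand : (‖a‖ - c * ‖b‖) ^ 2 / c = 1 / c * ‖a‖ ^ 2 - 2 * ‖a‖ * ‖b‖ + c * ‖b‖ ^ 2 := by
    field_simp
    ring
  linarith

theorem norm_add_sq_le_two_mul (a b : F) : ‖a + b‖ ^ 2 ≤ 2 * ‖a‖ ^ 2 + 2 * ‖b‖ ^ 2 := by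
  linarith [norm_add_sq_le_weighted a b one_pos]

end Seminormed

/-! ### Two-point difference quotients of smooth convex functions -/

section FirstOrder

variable {F : Type*} [NormedAddCommGroup F] [InnerProductSpace ℝ F] [CompleteSpace F]
  {Ω : Set F} {f : F → ℝ} {x y : F}

theorem add_inner_gradientWithin_le (hc : ConvexOn ℝ Ω f) (hd : DifferentiableWithinAt ℝ f Ω x)
    (hx : x ∈ Ω) (hy : y ∈ Ω) : f x + inner ℝ (gradientWithin f Ω x) (y - x) ≤ f y := by
  have h_maps : Set.MapsTo (AffineMap.lineMap x y : ℝ → F) (Set.Icc 0 1) Ω :=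
    fun t ht => hc.1.lineMap_mem hx hy ht
  have h_convex : ConvexOn ℝ (Set.Icc (0 : ℝ) 1) (f ∘ (AffineMap.lineMap x y : ℝ →ᵃ[ℝ] F)) :=
    (hc.comp_affineMap _).subset h_maps (convex_Icc _ _)
  have h_deriv := HasFDerivWithinAt.comp_hasDerivWithinAt (l := f) (t := Ω)
    (l' := InnerProductSpace.toDual ℝ F (gradientWithin f Ω x)) (0 : ℝ)
    (by simpa using hd.hasGradientWithinAt.hasFDerivWithinAt)
    (AffineMap.hasDerivWithinAt_lineMap (a := x) (b := y)) h_maps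
  have h_slope := h_convex.le_slope_of_hasDerivWithinAt (by simp) (by simp) zero_lt_one h_deriv
  rw [InnerProductSpace.toDual_apply_apply, slope_def_field] at h_slope
  simp only [Function.comp_apply, AffineMap.lineMap_apply_one, AffineMap.lineMap_apply_zero,
    sub_zero, div_one] at h_slope
  linarith

theorem sub_sub_inner_gradientWithin_le (hc : ConvexOn ℝ Ω f)
    (hd : DifferentiableWithinAt ℝ f Ω y) (hx : x ∈ Ω) (hy : y ∈ Ω) :
    f y - f x - inner ℝ (gradientWithin f Ω x) (y - x)
      ≤ inner ℝ (gradientWithin f Ω y - gradientWithin f Ω x) (y - x) := by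
  have h := add_inner_gradientWithin_le hc hd hy hx
  rw [← neg_sub y x, inner_neg_right] at h
  rw [inner_sub_left]
  linarith

end FirstOrder

section DiffQuot

variable {Ω : Set (E d)} {f : E d → ℝ} {L G δ : ℝ} {x : E d}

theorem abs_symmetric_sub_sub_inner_gradientWithin_le (hc : ConvexOn ℝ Ω f) (hs : SmoothOn L Ω f)
    (hx : x ∈ Ω) {h : E d} (hp : x + h ∈ Ω) (hm : x - h ∈ Ω) :
    |f (x + h) - f (x - h) - 2 * inner ℝ (gradientWithin f Ω x) h| ≤ L * ‖h‖ ^ 2 := by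
  have h_excess : ∀ y ∈ Ω, f y - f x - inner ℝ (gradientWithin f Ω x) (y - x)
      ∈ Set.Icc 0 (L * ‖y - x‖ ^ 2) := fun y hy => by
    refine ⟨by linarith [add_inner_gradientWithin_le hc (hs.1 x hx) hx hy], ?_⟩
    calc _ ≤ _ := sub_sub_inner_gradientWithin_le hc (hs.1 y hy) hx hy
      _ ≤ ‖gradientWithin f Ω y - gradientWithin f Ω x‖ * ‖y - x‖ := real_inner_le_norm _ _
      _ ≤ L * ‖y - x‖ * ‖y - x‖ := by gcongr; exact hs.2 y hy x hx
      _ = L * ‖y - x‖ ^ 2 := by ring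
  have h_plus := h_excess _ hp
  have h_minus := h_excess _ hm
  rw [add_sub_cancel_left] at h_plus
  rw [sub_sub_cancel_left, norm_neg, inner_neg_right] at h_minus
  rw [abs_le]
  constructor <;> linarith [h_plus.1, h_plus.2, h_minus.1, h_minus.2]

/-- The vector of two-point difference quotients of `f` at `x` with increment `δ` along the
coordinate axes. Its `k`-th entry is what a round of META observes when it draws coordinate `k`. -/
noncomputable def diffQuot (δ : ℝ) (f : E d → ℝ) (x : E d) : E d :=
  WithLp.toLp 2 fun k => (f (x + δ • EuclideanSpace.single k (1 : ℝ)) -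
    f (x - δ • EuclideanSpace.single k (1 : ℝ))) / (2 * δ)

theorem norm_le_sqrt_card_mul {c : ℝ} (hc : 0 ≤ c) (h : ∀ k, |x k| ≤ c) : ‖x‖ ≤ √d * c := by
  rw [EuclideanSpace.norm_eq]
  calc √(∑ k, ‖x k‖ ^ 2) ≤ √(∑ _k : Fin d, c ^ 2) := by
        gcongr with k
        exact h k
    _ = √d * c := by
        rw [Finset.sum_const, Finset.card_univ, Fintype.card_fin, nsmul_eq_mul,
          Real.sqrt_mul (Nat.cast_nonneg d), Real.sqrt_sq hc]

theorem norm_smul_single (hδ : 0 ≤ δ) (k : Fin d) :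
    ‖δ • (EuclideanSpace.single k (1 : ℝ) : E d)‖ = δ := by
  rw [norm_smul, PiLp.norm_single, norm_one, mul_one, Real.norm_of_nonneg hδ]

theorem add_smul_single_mem_closedBall (hδ : 0 ≤ δ) (x : E d) (k : Fin d) :
    x + δ • EuclideanSpace.single k (1 : ℝ) ∈ Metric.closedBall x δ := by
  rw [mem_closedBall_iff_norm, add_sub_cancel_left, norm_smul_single hδ]

theorem sub_smul_single_mem_closedBall (hδ : 0 ≤ δ) (x : E d) (k : Fin d) :
    x - δ • EuclideanSpace.single k (1 : ℝ) ∈ Metric.closedBall x δ := by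
  rw [mem_closedBall_iff_norm, sub_sub_cancel_left, norm_neg, norm_smul_single hδ]

theorem norm_diffQuot_sub_gradientWithin_le (hL : 0 ≤ L) (hδ : 0 < δ) (hc : ConvexOn ℝ Ω f)
    (hs : SmoothOn L Ω f) (hx : Metric.closedBall x δ ⊆ Ω) :
    ‖diffQuot δ f x - gradientWithin f Ω x‖ ≤ √d * (L * δ / 2) := by
  refine norm_le_sqrt_card_mul (by positivity) fun k => ?_
  have h := abs_symmetric_sub_sub_inner_gradientWithin_le hc hs
    (hx (Metric.mem_closedBall_self hδ.le)) (hx (add_smul_single_mem_closedBall hδ.le x k))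
    (hx (sub_smul_single_mem_closedBall hδ.le x k))
  rw [norm_smul_single hδ.le, real_inner_smul_right, EuclideanSpace.inner_single_right] at h
  have h_entry : (diffQuot δ f x - gradientWithin f Ω x) k * (2 * δ)
      = f (x + δ • EuclideanSpace.single k (1 : ℝ)) - f (x - δ • EuclideanSpace.single k (1 : ℝ))
        - 2 * (δ * (1 * gradientWithin f Ω x k)) := by
    simp only [diffQuot, PiLp.sub_apply]
    field_simp
  refine le_of_mul_le_mul_right ?_ (by positivity : 0 < 2 * δ)
  rw [← abs_of_pos (by positivity : 0 < 2 * δ), ← abs_mul, h_entry,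
    abs_of_pos (by positivity : 0 < 2 * δ)]
  exact h.trans_eq (by ring)

theorem norm_diffQuot_le (hG : 0 ≤ G) (hδ : 0 < δ)
    (hf : ∀ w ∈ Ω, ∀ w' ∈ Ω, |f w - f w'| ≤ G * ‖w - w'‖) (hx : Metric.closedBall x δ ⊆ Ω) :
    ‖diffQuot δ f x‖ ≤ √d * G := by
  refine norm_le_sqrt_card_mul hG fun k => ?_
  have h := hf _ (hx (add_smul_single_mem_closedBall hδ.le x k)) _
    (hx (sub_smul_single_mem_closedBall hδ.le x k))
  rw [add_sub_sub_cancel, ← two_smul ℝ, smul_smul, norm_smul_single (by positivity)] at h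
  rwa [diffQuot, abs_div, abs_of_pos (by positivity : 0 < 2 * δ), div_le_iff₀ (by positivity)]

end DiffQuot

/-! ### Averages over a coordinate -/

section Average

variable (x z : E d)

theorem sum_inner_smul_single :
    ∑ k, inner ℝ (x k • EuclideanSpace.single k (1 : ℝ)) z = inner ℝ x z := by
  have h := (EuclideanSpace.basisFun (Fin d) ℝ).sum_repr x
  simp only [EuclideanSpace.basisFun_repr, EuclideanSpace.basisFun_apply] at h
  rw [← sum_inner, h]

theorem sum_norm_sq_smul_single :
    ∑ k, ‖x k • (EuclideanSpace.single k (1 : ℝ) : E d)‖ ^ 2 = ‖x‖ ^ 2 := by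
  simp only [EuclideanSpace.norm_sq_eq x, norm_smul, PiLp.norm_single, norm_one, mul_one]

theorem sum_norm_sq_sub_smul_single :
    ∑ k, ‖x - x k • EuclideanSpace.single k (1 : ℝ)‖ ^ 2 = ((d : ℝ) - 1) * ‖x‖ ^ 2 := by
  simp only [norm_sub_sq_real, real_inner_comm _ x, Finset.sum_add_distrib, Finset.sum_sub_distrib,
    ← Finset.mul_sum, sum_norm_sq_smul_single, sum_inner_smul_single, real_inner_self_eq_norm_sq,
    Finset.sum_const, Finset.card_univ, Fintype.card_fin, nsmul_eq_mul]
  ring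

end Average

/-! ### Expectations along independent uniform coordinates -/

section Independence

variable {P ι : Type*} [MeasurableSpace P] {μ : Measure P} [IsProbabilityMeasure μ]
  [MeasurableSpace ι] [MeasurableSingletonClass ι]

theorem integral_eq_integral_sum_of_indepFun [Fintype ι] {γ V : Type*} [Finite γ]
    [MeasurableSpace γ] [MeasurableSingletonClass γ] [NormedAddCommGroup V] [NormedSpace ℝ V]
    [CompleteSpace V] {Y : P → ι} {Z : P → γ} (hYZ : IndepFun Y Z μ) (hY : Measurable Y)
    (hZ : Measurable Z) (F : ι → γ → V) :
    ∫ ω, F (Y ω) (Z ω) ∂μ = ∫ ω, ∑ k, μ.real (Y ⁻¹' {k}) • F k (Z ω) ∂μ := by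
  have := Measure.isProbabilityMeasure_map (μ := μ) hY.aemeasurable
  have := Measure.isProbabilityMeasure_map (μ := μ) hZ.aemeasurable
  calc ∫ ω, F (Y ω) (Z ω) ∂μ
      = ∫ p, F p.1 p.2 ∂μ.map fun ω => (Y ω, Z ω) :=
        (integral_map (f := fun p : ι × γ => F p.1 p.2) (hY.prodMk hZ).aemeasurable
          Integrable.of_finite.1).symm
    _ = ∫ p, F p.1 p.2 ∂(μ.map Y).prod (μ.map Z) := by
        rw [(indepFun_iff_map_prod_eq_prod_map_map hY.aemeasurable hZ.aemeasurable).1 hYZ]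
    _ = ∫ z, ∫ k, F k z ∂μ.map Y ∂μ.map Z := integral_prod_symm _ Integrable.of_finite
    _ = ∫ z, ∑ k, μ.real (Y ⁻¹' {k}) • F k z ∂μ.map Z := by
        simp only [integral_fintype Integrable.of_finite,
          map_measureReal_apply hY (measurableSet_singleton _)]
    _ = ∫ ω, ∑ k, μ.real (Y ⁻¹' {k}) • F k (Z ω) ∂μ :=
        integral_map hZ.aemeasurable Integrable.of_finite.1

theorem integrable_of_dependsOn [Finite ι] {τ V : Type*} [NormedAddCommGroup V]
    {i : τ → P → ι} (hi : ∀ t, Measurable (i t)) {s : Finset τ} {Φ : (τ → ι) → V}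
    (hΦ : DependsOn Φ (s : Set τ)) : Integrable (fun ω => Φ fun t => i t ω) μ := by
  obtain ⟨φ, rfl⟩ := dependsOn_iff_exists_comp.1 hΦ
  have h_meas : Measurable fun ω (t : s) => i t ω := measurable_pi_lambda _ fun t => hi t
  have := Measure.isProbabilityMeasure_map (μ := μ) h_meas.aemeasurable
  exact (Integrable.of_finite (f := φ)
    (μ := μ.map fun ω (t : s) => i t ω)).comp_measurable h_meas

end Independence

section Uniform

variable {P : Type*} [MeasurableSpace P] {μ : Measure P} [IsProbabilityMeasure μ]
  {i : ℕ → P → Fin d}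

theorem integral_eq_integral_average_update (hi : IsUniformIID μ i) {s : Finset ℕ} {n : ℕ}
    (hn : n ∉ s) {Φ : (ℕ → Fin d) → ℝ} (hΦ : DependsOn Φ (insert n s : Finset ℕ)) :
    ∫ ω, Φ (fun t => i t ω) ∂μ
      = ∫ ω, (∑ k, Φ (Function.update (fun t => i t ω) n k)) / d ∂μ := by
  set F : Fin d → (s → Fin d) → ℝ := fun k z => Φ fun t => if h : t ∈ s then z ⟨t, h⟩ else k
  have hF : ∀ k j, Φ (Function.update j n k) = F k fun t : s => j t := fun k j =>
    hΦ fun t ht => by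
      rcases Finset.mem_insert.1 ht with rfl | hts
      · simp only [Function.update_self, dif_neg hn]
      · rw [Function.update_of_ne (ne_of_mem_of_not_mem hts hn), dif_pos hts]
  have h_indep : IndepFun (i n) (fun ω (t : s) => i t ω) μ :=
    (hi.2.1.indepFun_finset {n} s (by simpa using hn) hi.1).comp
      (φ := fun z : ({n} : Finset ℕ) → Fin d => z ⟨n, Finset.mem_singleton_self n⟩)
      (measurable_of_finite _) measurable_id
  calc ∫ ω, Φ (fun t => i t ω) ∂μ = ∫ ω, F (i n ω) (fun t : s => i t ω) ∂μ := by
        refine integral_congr_ae (ae_of_all _ fun ω => ?_)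
        exact (congrArg Φ (Function.update_eq_self n fun t => i t ω)).symm.trans (hF _ _)
    _ = ∫ ω, ∑ k, μ.real (i n ⁻¹' {k}) • F k (fun t : s => i t ω) ∂μ :=
        integral_eq_integral_sum_of_indepFun h_indep (hi.1 n)
          (measurable_pi_lambda _ fun t => hi.1 t) F
    _ = _ := by
        simp only [hF, Measure.real, hi.2.2, ENNReal.toReal_inv, ENNReal.toReal_natCast,
          smul_eq_mul, inv_mul_eq_div, Finset.sum_div]

theorem integral_le_of_average_update_le (hi : IsUniformIID μ i) {Φ : ℕ → (ℕ → Fin d) → ℝ}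
    {c : ℕ → ℝ} {N : ℕ} (hΦ : ∀ n, DependsOn (Φ n) (Finset.Icc 1 n : Finset ℕ))
    (hstep : ∀ n < N, ∀ j,
      (∑ k, Φ (n + 1) (Function.update j (n + 1) k)) / d ≤ Φ n j + c (n + 1)) :
    ∫ ω, Φ N (fun t => i t ω) ∂μ
      ≤ ∫ ω, Φ 0 (fun t => i t ω) ∂μ + ∑ t ∈ Finset.Icc 1 N, c t := by
  induction N with
  | zero => simp
  | succ N ih =>
    have h_insert : insert (N + 1) (Finset.Icc 1 N) = Finset.Icc 1 (N + 1) := by grind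
    have h_average : DependsOn (fun j => (∑ k, Φ (N + 1) (Function.update j (N + 1) k)) / d)
        (Finset.Icc 1 N : Finset ℕ) := fun x y hxy => by
      refine congrArg (· / (d : ℝ)) (Finset.sum_congr rfl fun k _ => hΦ (N + 1) fun t ht => ?_)
      rw [← h_insert, Finset.coe_insert] at ht
      simp only [Function.update_apply]
      split_ifs with h
      · rfl
      · exact hxy t (ht.resolve_left h)
    calc ∫ ω, Φ (N + 1) (fun t => i t ω) ∂μ
        = ∫ ω, (∑ k, Φ (N + 1) (Function.update (fun t => i t ω) (N + 1) k)) / d ∂μ :=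
          integral_eq_integral_average_update hi (by simp) (h_insert ▸ hΦ (N + 1))
      _ ≤ ∫ ω, (Φ N (fun t => i t ω) + c (N + 1)) ∂μ :=
          integral_mono (integrable_of_dependsOn hi.1 h_average)
            ((integrable_of_dependsOn hi.1 (hΦ N)).add (integrable_const _))
            fun ω => hstep N N.lt_succ_self _
      _ = ∫ ω, Φ N (fun t => i t ω) ∂μ + c (N + 1) := by
          rw [integral_add (integrable_of_dependsOn hi.1 (hΦ N)) (integrable_const _),
            integral_const, probReal_univ, one_smul]
      _ ≤ _ := by
          rw [Finset.sum_Icc_succ_top (by omega)]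
          linarith [ih fun n hn => hstep n (hn.trans N.lt_succ_self)]

end Uniform

/-! ### The potential decrease of one round -/

/-- A loss that is convex, `G`-Lipschitz and `L`-smooth on `Ω`. -/
structure RegularLoss (L G : ℝ) (Ω : Set (E d)) (f : E d → ℝ) : Prop where
  convexOn : ConvexOn ℝ Ω f
  lipschitz : ∀ w ∈ Ω, ∀ w' ∈ Ω, |f w - f w'| ≤ G * ‖w - w'‖
  smooth : SmoothOn L Ω f

/-- A closed convex set `K` from whose points the queries at distance `δ` stay inside `Ω`; for META
it is `(1 - ξ) • Ω`. -/
structure IsCore (δ : ℝ) (K Ω : Set (E d)) : Prop where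
  isClosed : IsClosed K
  convex : Convex ℝ K
  closedBall_subset : ∀ x ∈ K, Metric.closedBall x δ ⊆ Ω

theorem IsCore.subset {δ : ℝ} {K Ω : Set (E d)} (hK : IsCore δ K Ω) (hδ : 0 ≤ δ) :
    K ⊆ Ω :=
  fun x hx => hK.closedBall_subset x hx (Metric.mem_closedBall_self hδ)

/-- The invariant of the states met by META: `ŵ` is the optimistic step from `w ∈ K` that uses the
current gradient estimate as prediction. -/
structure IsReachable (K : Set (E d)) (η : ℝ) (s : MetaState d) : Prop where
  w_mem : s.w ∈ K
  isProj_wHat : IsProj K (s.w - η • s.gHat) s.wHat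

theorem isReachable_metaStep {K : Set (E d)} (hK : IsClosed K) (hne : K.Nonempty)
    (δ η : ℝ) (f : E d → ℝ) (k : Fin d) (s : MetaState d) :
    IsReachable K η (metaStep K δ η f k s) :=
  ⟨(isProj_proj hK hne _).1, isProj_proj hK hne _⟩

theorem isReachable_metaRun {K : Set (E d)} (hK : IsClosed K) (h0 : 0 ∈ K) (δ η : ℝ)
    (f : ℕ → E d → ℝ) (j : ℕ → Fin d) : ∀ n, IsReachable K η (metaRun K δ η f j n)
  | 0 => ⟨h0, h0, fun z _ => by simp [metaRun]⟩
  | _ + 1 => isReachable_metaStep hK ⟨0, h0⟩ _ _ _ _ _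

/-- The loss of a round in state `s` with random coordinate `k`, averaged over the two queries. -/
noncomputable def queryLoss (δ : ℝ) (f : E d → ℝ) (s : MetaState d) (k : Fin d) : ℝ :=
  (f (queryPlus δ s k) + f (queryMinus δ s k)) / 2

/-- The potential of state `s` before a round with loss `f` and comparator `u`. The second term
tracks the error of the gradient estimate; the negative term is the progress that the optimistic
step has already made. -/
noncomputable def potential (δ η : ℝ) (f : E d → ℝ) (u : E d) (s : MetaState d) : ℝ :=
  ‖s.w - u‖ ^ 2 / (2 * η) + 2 * η * (d : ℝ) ^ 2 * ‖diffQuot δ f s.wHat - s.gHat‖ ^ 2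
    - ‖s.w - s.wHat‖ ^ 2 / (4 * η)

section OneRound

variable {Ω K : Set (E d)} {L G δ η q r : ℝ} {f f' : E d → ℝ} {s : MetaState d} {u u' : E d}

theorem queryLoss_le (hδ : 0 ≤ δ) (hf : ∀ w ∈ Ω, ∀ w' ∈ Ω, |f w - f w'| ≤ G * ‖w - w'‖)
    (hs : Metric.closedBall s.wHat δ ⊆ Ω) (k : Fin d) :
    queryLoss δ f s k ≤ f s.wHat + G * δ := by
  have h_center := hs (Metric.mem_closedBall_self hδ)
  have h_plus := hf _ (hs (add_smul_single_mem_closedBall hδ s.wHat k)) _ h_center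
  have h_minus := hf _ (hs (sub_smul_single_mem_closedBall hδ s.wHat k)) _ h_center
  rw [add_sub_cancel_left, norm_smul_single hδ] at h_plus
  rw [sub_sub_cancel_left, norm_neg, norm_smul_single hδ] at h_minus
  unfold queryLoss queryPlus queryMinus
  linarith [le_of_abs_le h_plus, le_of_abs_le h_minus]

theorem queryLoss_sub_le_mul_add (hδ : 0 ≤ δ) (hG : 0 ≤ G)
    (hf : ∀ w ∈ Ω, ∀ w' ∈ Ω, |f w - f w'| ≤ G * ‖w - w'‖)
    (hs : Metric.closedBall s.wHat δ ⊆ Ω) (hu : u ∈ Ω) (hr : ‖s.wHat - u‖ ≤ r) (k : Fin d) :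
    queryLoss δ f s k - f u ≤ G * (r + δ) := by
  have h_center := le_of_abs_le (hf _ (hs (Metric.mem_closedBall_self hδ)) u hu)
  have h_dist : G * ‖s.wHat - u‖ ≤ G * r := by gcongr
  linarith [queryLoss_le hδ hf hs k]

theorem queryLoss_sub_le_inner_diffQuot (hL : 0 ≤ L) (hδ : 0 < δ) (hf : RegularLoss L G Ω f)
    (hs : Metric.closedBall s.wHat δ ⊆ Ω) (hu : u ∈ Ω) (hr : ‖s.wHat - u‖ ≤ r) (k : Fin d) :
    queryLoss δ f s k - f u
      ≤ inner ℝ (diffQuot δ f s.wHat) (s.wHat - u) + G * δ + √d * (L * δ / 2) * r := by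
  have h_center := hs (Metric.mem_closedBall_self hδ.le)
  have h_tangent :=
    add_inner_gradientWithin_le hf.convexOn (hf.smooth.1 _ h_center) h_center hu
  rw [← neg_sub s.wHat u, inner_neg_right] at h_tangent
  have h_bias : inner ℝ (gradientWithin f Ω s.wHat - diffQuot δ f s.wHat) (s.wHat - u)
      ≤ √d * (L * δ / 2) * r := by
    refine (real_inner_le_norm _ _).trans ?_
    rw [norm_sub_rev]
    have := norm_diffQuot_sub_gradientWithin_le hL hδ hf.convexOn hf.smooth hs
    gcongr
  rw [inner_sub_left] at h_bias
  linarith [queryLoss_le hδ.le hf.lipschitz hs k]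

theorem norm_diffQuot_sub_diffQuot_sq_le (hL : 0 ≤ L) (hδ : 0 < δ) (hf : RegularLoss L G Ω f)
    (hf' : RegularLoss L G Ω f')
    (hq : ∀ w ∈ Ω, ‖gradientWithin f' Ω w - gradientWithin f Ω w‖ ^ 2 ≤ q) {x x' : E d}
    (hx : Metric.closedBall x δ ⊆ Ω) (hx' : Metric.closedBall x' δ ⊆ Ω) :
    ‖diffQuot δ f' x' - diffQuot δ f x‖ ^ 2
      ≤ 2 * L ^ 2 * ‖x' - x‖ ^ 2 + 4 * (q + d * L ^ 2 * δ ^ 2) := by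
  have hxΩ := hx (Metric.mem_closedBall_self hδ.le)
  have hxΩ' := hx' (Metric.mem_closedBall_self hδ.le)
  set a := gradientWithin f Ω x' - gradientWithin f Ω x
  set b := gradientWithin f' Ω x' - gradientWithin f Ω x'
  set c := diffQuot δ f' x' - gradientWithin f' Ω x' - (diffQuot δ f x - gradientWithin f Ω x)
  have h_split : diffQuot δ f' x' - diffQuot δ f x = a + (b + c) := by
    simp only [a, b, c]
    abel
  have h_move : ‖a‖ ^ 2 ≤ L ^ 2 * ‖x' - x‖ ^ 2 := by
    rw [← mul_pow]
    gcongr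
    exact hf.smooth.2 x' hxΩ' x hxΩ
  have h_bias : ‖c‖ ^ 2 ≤ d * L ^ 2 * δ ^ 2 := by
    calc ‖c‖ ^ 2 ≤ (√d * (L * δ / 2) + √d * (L * δ / 2)) ^ 2 := by
          gcongr
          exact (norm_sub_le _ _).trans (add_le_add
            (norm_diffQuot_sub_gradientWithin_le hL hδ hf'.convexOn hf'.smooth hx')
            (norm_diffQuot_sub_gradientWithin_le hL hδ hf.convexOn hf.smooth hx))
      _ = √d ^ 2 * L ^ 2 * δ ^ 2 := by ring
      _ = d * L ^ 2 * δ ^ 2 := by rw [Real.sq_sqrt (Nat.cast_nonneg d)]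
  rw [h_split]
  linarith [norm_add_sq_le_two_mul a (b + c), norm_add_sq_le_two_mul b c, hq x' hxΩ']

theorem metaStep_gHat (K : Set (E d)) (δ η : ℝ) (f : E d → ℝ) (k : Fin d) (s : MetaState d) :
    (metaStep K δ η f k s).gHat
      = (diffQuot δ f s.wHat - s.gHat) k • EuclideanSpace.single k (1 : ℝ) + s.gHat := rfl

theorem metaStep_w (K : Set (E d)) (δ η : ℝ) (f : E d → ℝ) (k : Fin d) (s : MetaState d) :
    (metaStep K δ η f k s).w = proj K (s.w - η • ((d : ℝ) •
      (diffQuot δ f s.wHat - s.gHat) k • EuclideanSpace.single k (1 : ℝ) + s.gHat)) := by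
  rw [smul_smul]
  rfl

theorem inner_metaStep_le (hη : 0 < η) (hKc : IsClosed K) (hK : Convex ℝ K)
    (hs : IsReachable K η s) (hu : u ∈ K) (δ : ℝ) (f : E d → ℝ) (k : Fin d) {x y : E d}
    (hx : x = diffQuot δ f s.wHat - s.gHat) (hy : y = x k • EuclideanSpace.single k (1 : ℝ))
    {s' : MetaState d} (hs' : s' = metaStep K δ η f k s) :
    inner ℝ ((d : ℝ) • y + s.gHat) (s.wHat - u)
      ≤ (‖s.w - u‖ ^ 2 - ‖s'.w - u‖ ^ 2) / (2 * η) + η * d ^ 2 * ‖y‖ ^ 2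
        - ‖s.wHat - s'.w‖ ^ 2 / (4 * η) - ‖s.w - s.wHat‖ ^ 2 / (2 * η) := by
  have h_proj : IsProj K (s.w - η • ((d : ℝ) • y + s.gHat)) s'.w := by
    rw [hs', metaStep_w, hy, hx]
    exact isProj_proj hKc ⟨u, hu⟩ _
  have h := inner_optimistic_step_le hη (h_proj.inner_le_zero hK hu)
    (hs.isProj_wHat.inner_le_zero hK h_proj.1)
  rwa [add_sub_cancel_right, norm_smul, RCLike.norm_natCast, mul_pow, ← mul_assoc] at h

/-- With weight `2 * D` in Young's inequality the growth factor is `1 + 1 / (2 * D)`, which the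
contraction factor `1 - 1 / D` of the coordinate update outweighs. -/
theorem two_mul_norm_add_sq_le {F : Type*} [SeminormedAddCommGroup F] (a b : F) {D : ℝ}
    (hη : 0 ≤ η) (hD : 1 ≤ D) :
    2 * η * D ^ 2 * ‖a + b‖ ^ 2
      ≤ (2 * η * D ^ 2 + η * D) * ‖a‖ ^ 2 + 6 * η * D ^ 3 * ‖b‖ ^ 2 := by
  calc 2 * η * D ^ 2 * ‖a + b‖ ^ 2
      ≤ 2 * η * D ^ 2 * ((1 + 1 / (2 * D)) * ‖a‖ ^ 2 + (D + 2 * D) * ‖b‖ ^ 2) := by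
        gcongr
        refine (norm_add_sq_le_weighted a b (by positivity : 0 < 2 * D)).trans ?_
        gcongr
    _ = (2 * η * D ^ 2 + η * D) * ‖a‖ ^ 2 + 6 * η * D ^ 3 * ‖b‖ ^ 2 := by
        field_simp
        ring

theorem estimation_error_le (hL : 0 ≤ L) (hδ : 0 < δ) (hη : 0 < η)
    (hηL : 96 * η ^ 2 * (d : ℝ) ^ 3 * L ^ 2 ≤ 1) (hd : 0 < d) (hf : RegularLoss L G Ω f)
    (hf' : RegularLoss L G Ω f')
    (hq : ∀ w ∈ Ω, ‖gradientWithin f' Ω w - gradientWithin f Ω w‖ ^ 2 ≤ q) {w x x' g : E d}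
    (hx : Metric.closedBall x δ ⊆ Ω) (hx' : Metric.closedBall x' δ ⊆ Ω) :
    2 * η * d ^ 2 * ‖diffQuot δ f' x' - g‖ ^ 2
      ≤ (2 * η * d ^ 2 + η * d) * ‖diffQuot δ f x - g‖ ^ 2
        + (‖w - x'‖ ^ 2 + ‖x - w‖ ^ 2) / (4 * η) + 24 * η * d ^ 3 * (q + d * L ^ 2 * δ ^ 2) := by
  have h_move : ‖x' - x‖ ^ 2 ≤ 2 * ‖w - x'‖ ^ 2 + 2 * ‖x - w‖ ^ 2 := by
    simpa only [sub_add_sub_cancel, norm_sub_rev x' w, norm_sub_rev w x] using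
      norm_add_sq_le_two_mul (x' - w) (w - x)
  have h_drift := norm_diffQuot_sub_diffQuot_sq_le hL hδ hf hf' hq hx hx'
  have h_coef : 24 * η * d ^ 3 * L ^ 2 ≤ 1 / (4 * η) := by
    rw [le_div_iff₀ (by positivity)]
    linarith
  set m := ‖w - x'‖ ^ 2 + ‖x - w‖ ^ 2
  calc 2 * η * d ^ 2 * ‖diffQuot δ f' x' - g‖ ^ 2
      ≤ (2 * η * d ^ 2 + η * d) * ‖diffQuot δ f x - g‖ ^ 2
        + 6 * η * d ^ 3 * ‖diffQuot δ f' x' - diffQuot δ f x‖ ^ 2 := by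
        simpa only [sub_add_sub_cancel'] using two_mul_norm_add_sq_le (diffQuot δ f x - g)
          (diffQuot δ f' x' - diffQuot δ f x) hη.le (by exact_mod_cast hd)
    _ ≤ (2 * η * d ^ 2 + η * d) * ‖diffQuot δ f x - g‖ ^ 2
        + 6 * η * d ^ 3 * (2 * L ^ 2 * (2 * m) + 4 * (q + d * L ^ 2 * δ ^ 2)) := by
        gcongr
        refine h_drift.trans ?_
        gcongr
        linarith
    _ = (2 * η * d ^ 2 + η * d) * ‖diffQuot δ f x - g‖ ^ 2
        + 24 * η * d ^ 3 * L ^ 2 * m + 24 * η * d ^ 3 * (q + d * L ^ 2 * δ ^ 2) := by ring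
    _ ≤ (2 * η * d ^ 2 + η * d) * ‖diffQuot δ f x - g‖ ^ 2
        + 1 / (4 * η) * m + 24 * η * d ^ 3 * (q + d * L ^ 2 * δ ^ 2) := by gcongr
    _ = _ := by ring

theorem queryLoss_add_potential_metaStep_le (hL : 0 ≤ L) (hδ : 0 < δ) (hη : 0 < η)
    (hηL : 96 * η ^ 2 * (d : ℝ) ^ 3 * L ^ 2 ≤ 1) (hK : IsCore δ K Ω) (hf : RegularLoss L G Ω f)
    (hf' : RegularLoss L G Ω f')
    (hq : ∀ w ∈ Ω, ‖gradientWithin f' Ω w - gradientWithin f Ω w‖ ^ 2 ≤ q) (hu : u ∈ K)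
    (hr : ∀ w ∈ K, ‖w - u‖ ≤ r) (hr' : ∀ w ∈ K, ‖w - u'‖ ≤ r) (hs : IsReachable K η s) (k : Fin d)
    {x y : E d} (hx : x = diffQuot δ f s.wHat - s.gHat)
    (hy : y = x k • EuclideanSpace.single k (1 : ℝ)) :
    queryLoss δ f s k - f u + potential δ η f' u' (metaStep K δ η f k s)
      ≤ ‖s.w - u‖ ^ 2 / (2 * η) - ‖s.w - s.wHat‖ ^ 2 / (4 * η) + inner ℝ x (s.wHat - u)
        - d * inner ℝ y (s.wHat - u) + η * d ^ 2 * ‖y‖ ^ 2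
        + (2 * η * d ^ 2 + η * d) * ‖x - y‖ ^ 2
        + (G * δ + √d * (L * δ / 2) * r + r * ‖u - u'‖ / η
          + 24 * η * d ^ 3 * (q + d * L ^ 2 * δ ^ 2)) := by
  set s' := metaStep K δ η f k s with hs'
  have hs'K : IsReachable K η s' := isReachable_metaStep hK.isClosed ⟨u, hu⟩ _ _ _ _ _
  have h_ball := hK.closedBall_subset _ hs.isProj_wHat.1
  have h_loss := queryLoss_sub_le_inner_diffQuot hL hδ hf h_ball (hK.subset hδ.le hu)
    (hr _ hs.isProj_wHat.1) k
  have h_step := inner_metaStep_le hη hK.isClosed hK.convex hs hu δ f k hx hy hs'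
  have h_error := estimation_error_le (w := s'.w) (g := s'.gHat) hL hδ hη hηL k.pos hf hf' hq
    h_ball (hK.closedBall_subset _ hs'K.isProj_wHat.1)
  have h_comparator : ‖s'.w - u'‖ ^ 2 / (2 * η) ≤ ‖s'.w - u‖ ^ 2 / (2 * η) + r * ‖u - u'‖ / η := by
    calc _ ≤ (‖s'.w - u‖ ^ 2 + 2 * r * ‖u - u'‖) / (2 * η) := by
          gcongr
          exact norm_sub_sq_le_of_norm_sub_le (hr _ hs'K.w_mem) (hr' _ hs'K.w_mem)
      _ = _ := by field_simp
  have h_residual : diffQuot δ f s.wHat - s'.gHat = x - y := by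
    rw [hs', metaStep_gHat, hy, hx]
    abel
  have h_inner : inner ℝ (diffQuot δ f s.wHat) (s.wHat - u)
      = inner ℝ x (s.wHat - u) + inner ℝ s.gHat (s.wHat - u) := by
    rw [← inner_add_left, hx, sub_add_cancel]
  have h_half : ‖s.w - s.wHat‖ ^ 2 / (2 * η) = 2 * (‖s.w - s.wHat‖ ^ 2 / (4 * η)) := by
    field_simp
    norm_num
  have h_gain : 0 ≤ ‖s.w - s.wHat‖ ^ 2 / (4 * η) := by positivity
  rw [inner_add_left, real_inner_smul_left, sub_div] at h_step
  rw [h_residual, add_div] at h_error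
  unfold potential
  linarith

/-- On average over `k` the linear terms of the pathwise bound cancel, and the error
`‖x‖ ^ 2` of the gradient estimate contracts by the factor `1 - 1 / d`. -/
theorem average_queryLoss_add_potential_metaStep_le (hd : 0 < d) (hL : 0 ≤ L) (hδ : 0 < δ)
    (hη : 0 < η) (hηL : 96 * η ^ 2 * (d : ℝ) ^ 3 * L ^ 2 ≤ 1) (hK : IsCore δ K Ω)
    (hf : RegularLoss L G Ω f) (hf' : RegularLoss L G Ω f')
    (hq : ∀ w ∈ Ω, ‖gradientWithin f' Ω w - gradientWithin f Ω w‖ ^ 2 ≤ q) (hu : u ∈ K)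
    (hr : ∀ w ∈ K, ‖w - u‖ ≤ r) (hr' : ∀ w ∈ K, ‖w - u'‖ ≤ r) (hs : IsReachable K η s) :
    (∑ k, (queryLoss δ f s k - f u + potential δ η f' u' (metaStep K δ η f k s))) / d
      ≤ potential δ η f u s + (G * δ + √d * (L * δ / 2) * r + r * ‖u - u'‖ / η
          + 24 * η * d ^ 3 * (q + d * L ^ 2 * δ ^ 2)) := by
  set x := diffQuot δ f s.wHat - s.gHat with hx
  have h_pathwise := Finset.sum_le_sum fun k (_ : k ∈ Finset.univ) =>
    queryLoss_add_potential_metaStep_le hL hδ hη hηL hK hf hf' hq hu hr hr' hs k hx rfl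
  rw [div_le_iff₀ (by exact_mod_cast hd)]
  refine h_pathwise.trans ?_
  simp only [Finset.sum_add_distrib, Finset.sum_sub_distrib, ← Finset.mul_sum,
    sum_inner_smul_single, sum_norm_sq_smul_single, sum_norm_sq_sub_smul_single, Finset.sum_const,
    Finset.card_univ, Fintype.card_fin, nsmul_eq_mul]
  unfold potential
  rw [← hx]
  have h_slack : 0 ≤ η * d * ‖x‖ ^ 2 := by positivity
  linarith

end OneRound

/-! ### The expected regret against a moving comparator -/

/-- The regret of META in its first `n` rounds against the comparators `u 1, u 2, …`, along the
coordinates `j`, with iterates projected onto `K` and queries at distance `δ`. -/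
noncomputable def runRegret (K : Set (E d)) (δ η : ℝ) (f : ℕ → E d → ℝ) (u : ℕ → E d)
    (j : ℕ → Fin d) (n : ℕ) : ℝ :=
  ∑ t ∈ Finset.Icc 1 n, (queryLoss δ (f t) (metaRun K δ η f j (t - 1)) (j t) - f t (u t))

theorem runRegret_succ (K : Set (E d)) (δ η : ℝ) (f : ℕ → E d → ℝ) (u : ℕ → E d)
    (j : ℕ → Fin d) (n : ℕ) :
    runRegret K δ η f u j (n + 1) = runRegret K δ η f u j n
      + (queryLoss δ (f (n + 1)) (metaRun K δ η f j n) (j (n + 1)) - f (n + 1) (u (n + 1))) :=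
  Finset.sum_Icc_succ_top (by omega) _

theorem dependsOn_metaRun (K : Set (E d)) (δ η : ℝ) (f : ℕ → E d → ℝ) (n : ℕ) :
    DependsOn (fun j => metaRun K δ η f j n) (Finset.Icc 1 n : Finset ℕ) := by
  induction n with
  | zero => exact fun _ _ _ => rfl
  | succ n ih =>
    intro j j' h
    have h_past : metaRun K δ η f j n = metaRun K δ η f j' n :=
      ih fun t ht => h t (Finset.Icc_subset_Icc_right n.le_succ ht)
    simp only [metaRun, h_past, h (n + 1) (Finset.right_mem_Icc.2 (by omega))]

theorem dependsOn_runRegret (K : Set (E d)) (δ η : ℝ) (f : ℕ → E d → ℝ) (u : ℕ → E d)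
    (n : ℕ) :
    DependsOn (fun j => runRegret K δ η f u j n) (Finset.Icc 1 n : Finset ℕ) := by
  intro j j' h
  refine Finset.sum_congr rfl fun t ht => ?_
  have h_past : metaRun K δ η f j (t - 1) = metaRun K δ η f j' (t - 1) :=
    dependsOn_metaRun K δ η f _ fun t' ht' =>
      h t' (Finset.Icc_subset_Icc_right (by grind) ht')
  rw [h_past, h t ht]

theorem metaRun_update (K : Set (E d)) (δ η : ℝ) (f : ℕ → E d → ℝ) (j : ℕ → Fin d) (n : ℕ)
    (k : Fin d) :
    metaRun K δ η f (Function.update j (n + 1) k) n = metaRun K δ η f j n :=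
  dependsOn_metaRun K δ η f n fun _ ht =>
    Function.update_of_ne (by simp only [Finset.coe_Icc, Set.mem_Icc] at ht; omega) _ _

theorem runRegret_update (K : Set (E d)) (δ η : ℝ) (f : ℕ → E d → ℝ) (u : ℕ → E d)
    (j : ℕ → Fin d) (n : ℕ) (k : Fin d) :
    runRegret K δ η f u (Function.update j (n + 1) k) n = runRegret K δ η f u j n :=
  dependsOn_runRegret K δ η f u n fun _ ht =>
    Function.update_of_ne (by simp only [Finset.coe_Icc, Set.mem_Icc] at ht; omega) _ _

section Regret

variable {Ω K : Set (E d)} {L G δ η r : ℝ} {f : ℕ → E d → ℝ} {u : ℕ → E d} {q : ℕ → ℝ}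

theorem potential_init_le {g : E d → ℝ} {v : E d} (hG : 0 ≤ G) (hδ : 0 < δ) (hη : 0 < η)
    (hg : ∀ w ∈ Ω, ∀ w' ∈ Ω, |g w - g w'| ≤ G * ‖w - w'‖) (h0 : Metric.closedBall 0 δ ⊆ Ω)
    (hv : ‖v‖ ≤ r) :
    potential δ η g v ⟨0, 0, 0⟩ ≤ r ^ 2 / (2 * η) + 2 * η * d ^ 3 * G ^ 2 := by
  have h_quot : ‖diffQuot δ g 0‖ ^ 2 ≤ d * G ^ 2 := by
    calc ‖diffQuot δ g 0‖ ^ 2 ≤ (√d * G) ^ 2 := by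
          gcongr
          exact norm_diffQuot_le hG hδ hg h0
      _ = d * G ^ 2 := by rw [mul_pow, Real.sq_sqrt (Nat.cast_nonneg d)]
  calc potential δ η g v ⟨0, 0, 0⟩
      = ‖v‖ ^ 2 / (2 * η) + 2 * η * d ^ 2 * ‖diffQuot δ g 0‖ ^ 2 := by simp [potential]
    _ ≤ r ^ 2 / (2 * η) + 2 * η * d ^ 2 * (d * G ^ 2) := by gcongr
    _ = _ := by ring

theorem neg_div_le_potential {g : E d → ℝ} {v : E d} {s : MetaState d} (hη : 0 < η)
    (hw : ‖s.w - v‖ ≤ r) (hwHat : ‖s.wHat - v‖ ≤ r) : -(r ^ 2 / η) ≤ potential δ η g v s := by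
  have h_dist : ‖s.w - s.wHat‖ ≤ 2 * r := by
    rw [← sub_sub_sub_cancel_right _ _ v]
    linarith [norm_sub_le (s.w - v) (s.wHat - v)]
  have h_neg : ‖s.w - s.wHat‖ ^ 2 / (4 * η) ≤ r ^ 2 / η := by
    calc ‖s.w - s.wHat‖ ^ 2 / (4 * η) ≤ (2 * r) ^ 2 / (4 * η) := by gcongr
      _ = r ^ 2 / η := by
        field_simp
        ring
  have h_pos : 0 ≤ ‖s.w - v‖ ^ 2 / (2 * η)
      + 2 * η * d ^ 2 * ‖diffQuot δ g s.wHat - s.gHat‖ ^ 2 := by positivity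
  unfold potential
  linarith

theorem runRegret_succ_le (hG : 0 ≤ G) (hδ : 0 ≤ δ) (hK : IsCore δ K Ω) (h0 : 0 ∈ K) {n : ℕ}
    (hf : RegularLoss L G Ω (f (n + 1))) (hu : u (n + 1) ∈ Ω)
    (hr : ∀ w ∈ K, ‖w - u (n + 1)‖ ≤ r) (η : ℝ) (j : ℕ → Fin d) :
    runRegret K δ η f u j (n + 1) ≤ runRegret K δ η f u j n + G * (r + δ) := by
  have hs := isReachable_metaRun hK.isClosed h0 δ η f j n
  rw [runRegret_succ]
  gcongr
  exact queryLoss_sub_le_mul_add hδ hG hf.lipschitz (hK.closedBall_subset _ hs.isProj_wHat.1) hu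
    (hr _ hs.isProj_wHat.1) _

theorem runRegret_le_mul (hG : 0 ≤ G) (hδ : 0 ≤ δ) (hK : IsCore δ K Ω) (h0 : 0 ∈ K) {T : ℕ}
    (hf : ∀ t ∈ Finset.Icc 1 T, RegularLoss L G Ω (f t)) (hu : ∀ t ∈ Finset.Icc 1 T, u t ∈ Ω)
    (hr : ∀ t ∈ Finset.Icc 1 T, ∀ w ∈ K, ‖w - u t‖ ≤ r) (η : ℝ) (j : ℕ → Fin d) :
    runRegret K δ η f u j T ≤ T * (G * (r + δ)) := by
  induction T with
  | zero => simp [runRegret]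
  | succ T ih =>
    have h_last : T + 1 ∈ Finset.Icc 1 (T + 1) := Finset.right_mem_Icc.2 (by omega)
    have h_past : Finset.Icc 1 T ⊆ Finset.Icc 1 (T + 1) := Finset.Icc_subset_Icc_right T.le_succ
    have h_regret := ih (fun t ht => hf t (h_past ht)) (fun t ht => hu t (h_past ht))
      fun t ht => hr t (h_past ht)
    push_cast
    linarith [runRegret_succ_le hG hδ hK h0 (hf _ h_last) (hu _ h_last) (hr _ h_last) η j]

theorem average_runRegret_add_potential_le (hL : 0 ≤ L) (hδ : 0 < δ) (hη : 0 < η)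
    (hηL : 96 * η ^ 2 * (d : ℝ) ^ 3 * L ^ 2 ≤ 1) (hK : IsCore δ K Ω) (h0 : 0 ∈ K) {n : ℕ}
    (hf : RegularLoss L G Ω (f (n + 1))) (hf' : RegularLoss L G Ω (f (n + 2))) {q : ℝ}
    (hq : ∀ w ∈ Ω, ‖gradientWithin (f (n + 2)) Ω w - gradientWithin (f (n + 1)) Ω w‖ ^ 2 ≤ q)
    (hu : u (n + 1) ∈ K) (hr : ∀ w ∈ K, ‖w - u (n + 1)‖ ≤ r)
    (hr' : ∀ w ∈ K, ‖w - u (n + 2)‖ ≤ r) (j : ℕ → Fin d) :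
    (∑ k, (runRegret K δ η f u (Function.update j (n + 1) k) (n + 1)
        + potential δ η (f (n + 2)) (u (n + 2))
          (metaRun K δ η f (Function.update j (n + 1) k) (n + 1)))) / d
      ≤ runRegret K δ η f u j n
        + potential δ η (f (n + 1)) (u (n + 1)) (metaRun K δ η f j n)
        + (G * δ + √d * (L * δ / 2) * r + r * ‖u (n + 1) - u (n + 2)‖ / η
          + 24 * η * d ^ 3 * (q + d * L ^ 2 * δ ^ 2)) := by
  have hd : (d : ℝ) ≠ 0 := by exact_mod_cast (j 0).pos.ne'
  simp only [runRegret_succ, runRegret_update, metaRun, metaRun_update, Function.update_self,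
    add_assoc (runRegret K δ η f u j n),
    Finset.sum_add_distrib (f := fun _ => runRegret _ _ _ _ _ _ _), Finset.sum_const,
    Finset.card_univ, Fintype.card_fin, nsmul_eq_mul, add_div, mul_div_cancel_left₀ _ hd]
  gcongr
  exact average_queryLoss_add_potential_metaStep_le (j 0).pos hL hδ hη hηL hK hf hf' hq hu hr hr'
    (isReachable_metaRun hK.isClosed h0 δ η f j n)

section Expectation

variable {P : Type*} [MeasurableSpace P] {μ : Measure P} [IsProbabilityMeasure μ]
  {i : ℕ → P → Fin d}

theorem integral_runRegret_add_potential_le (hL : 0 ≤ L) (hG : 0 ≤ G) (hδ : 0 < δ) (hη : 0 < η)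
    (hηL : 96 * η ^ 2 * (d : ℝ) ^ 3 * L ^ 2 ≤ 1) (hK : IsCore δ K Ω) (h0 : 0 ∈ K) {N : ℕ}
    (hf : ∀ t ∈ Finset.Icc 1 (N + 1), RegularLoss L G Ω (f t))
    (hq : ∀ t ∈ Finset.Icc 1 N, ∀ w ∈ Ω,
      ‖gradientWithin (f (t + 1)) Ω w - gradientWithin (f t) Ω w‖ ^ 2 ≤ q t)
    (hu : ∀ t ∈ Finset.Icc 1 (N + 1), u t ∈ K)
    (hr : ∀ t ∈ Finset.Icc 1 (N + 1), ∀ w ∈ K, ‖w - u t‖ ≤ r) (hi : IsUniformIID μ i) :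
    ∫ ω, (runRegret K δ η f u (fun t => i t ω) N
        + potential δ η (f (N + 1)) (u (N + 1)) (metaRun K δ η f (fun t => i t ω) N)) ∂μ
      ≤ r ^ 2 / (2 * η) + 2 * η * d ^ 3 * G ^ 2
        + ∑ t ∈ Finset.Icc 1 N, (G * δ + √d * (L * δ / 2) * r + r * ‖u t - u (t + 1)‖ / η
          + 24 * η * d ^ 3 * (q t + d * L ^ 2 * δ ^ 2)) := by
  have h_first : 1 ∈ Finset.Icc 1 (N + 1) := Finset.left_mem_Icc.2 (by omega)
  have h_dist : ‖u 1‖ ≤ r := by simpa only [zero_sub, norm_neg] using hr 1 h_first 0 h0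
  have h_start := potential_init_le hG hδ hη (hf 1 h_first).lipschitz
    (hK.closedBall_subset 0 h0) h_dist
  have h_descent := integral_le_of_average_update_le (N := N) hi
    (Φ := fun n j => runRegret K δ η f u j n
      + potential δ η (f (n + 1)) (u (n + 1)) (metaRun K δ η f j n))
    (c := fun t => G * δ + √d * (L * δ / 2) * r + r * ‖u t - u (t + 1)‖ / η
      + 24 * η * d ^ 3 * (q t + d * L ^ 2 * δ ^ 2))
    (fun n j j' h => by
      simp only [dependsOn_runRegret K δ η f u n h, dependsOn_metaRun K δ η f n h])
    fun n hn j => by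
      have h_mem : n + 1 ∈ Finset.Icc 1 (N + 1) := Finset.mem_Icc.2 (by omega)
      have h_mem' : n + 2 ∈ Finset.Icc 1 (N + 1) := Finset.mem_Icc.2 (by omega)
      exact average_runRegret_add_potential_le hL hδ hη hηL hK h0 (hf _ h_mem) (hf _ h_mem')
        (hq _ (Finset.mem_Icc.2 (by omega))) (hu _ h_mem) (hr _ h_mem) (hr _ h_mem') j
  refine h_descent.trans (add_le_add_left (le_of_eq_of_le ?_ h_start) _)
  simp [runRegret, metaRun]

theorem integral_runRegret_succ_le (hG : 0 ≤ G) (hδ : 0 ≤ δ) (hη : 0 < η) (hK : IsCore δ K Ω)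
    (h0 : 0 ∈ K) {n : ℕ} (hf : RegularLoss L G Ω (f (n + 1))) (hu : u (n + 1) ∈ Ω)
    (hr : ∀ w ∈ K, ‖w - u (n + 1)‖ ≤ r) (hi : IsUniformIID μ i) :
    ∫ ω, runRegret K δ η f u (fun t => i t ω) (n + 1) ∂μ
      ≤ ∫ ω, (runRegret K δ η f u (fun t => i t ω) n
          + potential δ η (f (n + 1)) (u (n + 1)) (metaRun K δ η f (fun t => i t ω) n)) ∂μ
        + (r ^ 2 / η + G * (r + δ)) := by
  have h_pathwise : ∀ j, runRegret K δ η f u j (n + 1) ≤ runRegret K δ η f u j n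
      + potential δ η (f (n + 1)) (u (n + 1)) (metaRun K δ η f j n)
      + (r ^ 2 / η + G * (r + δ)) := fun j => by
    have hs := isReachable_metaRun hK.isClosed h0 δ η f j n
    have h_potential := neg_div_le_potential (δ := δ) (g := f (n + 1)) hη
      (hr _ hs.w_mem) (hr _ hs.isProj_wHat.1)
    linarith [runRegret_succ_le hG hδ hK h0 hf hu hr η j]
  have h_int : Integrable (fun ω => runRegret K δ η f u (fun t => i t ω) n
      + potential δ η (f (n + 1)) (u (n + 1)) (metaRun K δ η f (fun t => i t ω) n)) μ :=
    integrable_of_dependsOn hi.1 (s := Finset.Icc 1 n)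
      (Φ := fun j => runRegret K δ η f u j n
        + potential δ η (f (n + 1)) (u (n + 1)) (metaRun K δ η f j n))
      fun j j' h => by
        simp only [dependsOn_runRegret K δ η f u n h, dependsOn_metaRun K δ η f n h]
  refine (integral_mono (integrable_of_dependsOn hi.1 (dependsOn_runRegret K δ η f u (n + 1)))
    (h_int.add (integrable_const _)) fun ω => h_pathwise _).trans_eq ?_
  simp only [Pi.add_apply]
  rw [integral_add h_int (integrable_const _), integral_const, probReal_univ, one_smul]

/-- The potential argument runs over the first `T - 1` rounds only, so that no loss after round `T`
is needed; the last round costs at most `G * (r + δ)`. -/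
theorem integral_runRegret_le (hL : 0 ≤ L) (hG : 0 ≤ G) (hδ : 0 < δ) (hη : 0 < η)
    (hηL : 96 * η ^ 2 * (d : ℝ) ^ 3 * L ^ 2 ≤ 1) (hK : IsCore δ K Ω) (h0 : 0 ∈ K) {T : ℕ}
    (hT : 1 ≤ T) (hf : ∀ t ∈ Finset.Icc 1 T, RegularLoss L G Ω (f t))
    (hq : ∀ t ∈ Finset.Ico 1 T, ∀ w ∈ Ω,
      ‖gradientWithin (f (t + 1)) Ω w - gradientWithin (f t) Ω w‖ ^ 2 ≤ q t)
    (hu : ∀ t ∈ Finset.Icc 1 T, u t ∈ K) (hr : ∀ t ∈ Finset.Icc 1 T, ∀ w ∈ K, ‖w - u t‖ ≤ r)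
    (hi : IsUniformIID μ i) :
    ∫ ω, runRegret K δ η f u (fun t => i t ω) T ∂μ
      ≤ (3 / 2 * r ^ 2 + r * ∑ t ∈ Finset.Ico 1 T, ‖u t - u (t + 1)‖) / η
        + 24 * η * d ^ 3 * (∑ t ∈ Finset.Ico 1 T, q t + T * (d * L ^ 2 * δ ^ 2))
        + 2 * η * d ^ 3 * G ^ 2 + T * (G * δ + √d * (L * δ / 2) * r) + G * r := by
  obtain ⟨N, rfl⟩ := Nat.exists_eq_add_of_le' hT
  have h_mem : N + 1 ∈ Finset.Icc 1 (N + 1) := Finset.right_mem_Icc.2 hT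
  have hr0 : 0 ≤ r := (norm_nonneg _).trans (hr _ h_mem 0 h0)
  have h_sum : ∑ t ∈ Finset.Icc 1 N, (G * δ + √d * (L * δ / 2) * r + r * ‖u t - u (t + 1)‖ / η
        + 24 * η * d ^ 3 * (q t + d * L ^ 2 * δ ^ 2))
      = N * (G * δ + √d * (L * δ / 2) * r) + r * (∑ t ∈ Finset.Icc 1 N, ‖u t - u (t + 1)‖) / η
        + 24 * η * d ^ 3 * (∑ t ∈ Finset.Icc 1 N, q t + N * (d * L ^ 2 * δ ^ 2)) := by
    simp only [Finset.sum_add_distrib, Finset.sum_const, Nat.card_Icc, Nat.add_sub_cancel,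
      nsmul_eq_mul, Finset.mul_sum, Finset.sum_div, mul_add]
    ring
  have h_last := integral_runRegret_succ_le hG hδ.le hη hK h0 (hf _ h_mem)
    (hK.subset hδ.le (hu _ h_mem)) (hr _ h_mem) hi
  have h_past := integral_runRegret_add_potential_le hL hG hδ hη hηL hK h0 hf
    (by simpa only [Finset.Ico_add_one_right_eq_Icc] using hq) hu hr hi
  have h_slack : 0 ≤ √d * (L * δ / 2) * r + 24 * η * d ^ 3 * (d * L ^ 2 * δ ^ 2) := by positivity
  have h_start : 3 / 2 * r ^ 2 / η = r ^ 2 / (2 * η) + r ^ 2 / η := by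
    field_simp
    ring
  rw [h_sum] at h_past
  rw [Finset.Ico_add_one_right_eq_Icc, add_div, h_start]
  push_cast
  linarith

end Expectation

end Regret

/-! ### Running META on a shrunken domain -/

theorem isCore_smul {Ω : Set (E d)} {R₁ ξ : ℝ} (hc : IsClosed Ω) (hΩ : Convex ℝ Ω)
    (hR₁ : 0 ≤ R₁) (hball : Metric.closedBall 0 R₁ ⊆ Ω) (hξ : 0 ≤ ξ) (hξ1 : ξ ≤ 1) :
    IsCore (ξ * R₁) ((1 - ξ) • Ω) Ω where
  isClosed := hc.smul₀ _
  convex := hΩ.smul _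
  closedBall_subset x hx y hy := by
    rw [mem_closedBall_iff_norm] at hy
    have hyx : y - x ∈ ξ • Ω := by
      refine Set.smul_set_mono hball ?_
      rw [smul_closedBall _ _ hR₁, smul_zero, mem_closedBall_zero_iff, Real.norm_of_nonneg hξ]
      exact hy
    have h_combo := hΩ.set_combo_subset (sub_nonneg.2 hξ1) hξ (sub_add_cancel 1 ξ)
      (Set.add_mem_add hx hyx)
    rwa [add_sub_cancel] at h_combo

/-- The data of a tracking problem with horizon `T`: `L`-smooth convex `G`-Lipschitz losses `f` on a
closed convex domain `Ω` containing the ball of radius `R₁`, and comparators `u` within distance `r`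
of every point of `Ω`. -/
structure TrackingProblem (L G r R₁ : ℝ) (T : ℕ) (Ω : Set (E d)) (f : ℕ → E d → ℝ)
    (u : ℕ → E d) : Prop where
  isClosed : IsClosed Ω
  convex : Convex ℝ Ω
  closedBall_subset : Metric.closedBall 0 R₁ ⊆ Ω
  regularLoss : ∀ t ∈ Finset.Icc 1 T, RegularLoss L G Ω (f t)
  mem : ∀ t ∈ Finset.Icc 1 T, u t ∈ Ω
  norm_sub_le : ∀ t ∈ Finset.Icc 1 T, ∀ w ∈ Ω, ‖w - u t‖ ≤ r

theorem sum_norm_smul_sub_smul_le {F : Type*} [SeminormedAddCommGroup F] [NormedSpace ℝ F] {c : ℝ}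
    (hc : 0 ≤ c) (hc1 : c ≤ 1) (u : ℕ → F) (s : Finset ℕ) :
    ∑ t ∈ s, ‖c • u t - c • u (t + 1)‖ ≤ ∑ t ∈ s, ‖u t - u (t + 1)‖ :=
  Finset.sum_le_sum fun t _ => by
    rw [← smul_sub, norm_smul, Real.norm_of_nonneg hc]
    exact mul_le_of_le_one_left (norm_nonneg _) hc1

section TrackingProblem

variable {L G r R₁ ξ η : ℝ} {T : ℕ} {Ω : Set (E d)} {f : ℕ → E d → ℝ} {u : ℕ → E d} {q : ℕ → ℝ}

theorem TrackingProblem.zero_mem (h : TrackingProblem L G r R₁ T Ω f u) (hR₁ : 0 ≤ R₁) : 0 ∈ Ω :=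
  h.closedBall_subset (Metric.mem_closedBall_self hR₁)

theorem TrackingProblem.isCore (h : TrackingProblem L G r R₁ T Ω f u) (hR₁ : 0 ≤ R₁) (hξ : 0 ≤ ξ)
    (hξ1 : ξ ≤ 1) : IsCore (ξ * R₁) ((1 - ξ) • Ω) Ω :=
  isCore_smul h.isClosed h.convex hR₁ h.closedBall_subset hξ hξ1

theorem TrackingProblem.norm_sub_smul_le (h : TrackingProblem L G r R₁ T Ω f u) (hξ : 0 ≤ ξ)
    (hξ1 : ξ ≤ 1) {t : ℕ} (ht : t ∈ Finset.Icc 1 T) {w : E d} (hw : w ∈ (1 - ξ) • Ω) :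
    ‖w - (1 - ξ) • u t‖ ≤ r := by
  obtain ⟨y, hy, rfl⟩ := hw
  change ‖(1 - ξ) • y - (1 - ξ) • u t‖ ≤ r
  rw [← smul_sub, norm_smul, Real.norm_of_nonneg (sub_nonneg.2 hξ1)]
  exact (mul_le_of_le_one_left (norm_nonneg _) (sub_le_self 1 hξ)).trans (h.norm_sub_le t ht y hy)

theorem TrackingProblem.runRegret_le_runRegret_smul_add (h : TrackingProblem L G r R₁ T Ω f u)
    (hG : 0 ≤ G) (hR₁ : 0 ≤ R₁) (hξ : 0 ≤ ξ) (hξ1 : ξ ≤ 1) (K : Set (E d)) (δ η : ℝ)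
    (j : ℕ → Fin d) :
    runRegret K δ η f u j T
      ≤ runRegret K δ η f (fun t => (1 - ξ) • u t) j T + T * (ξ * (G * r)) := by
  have h_cost : ∀ t ∈ Finset.Icc 1 T, f t ((1 - ξ) • u t) - f t (u t) ≤ ξ * (G * r) := by
    intro t ht
    have h0 := h.zero_mem hR₁
    have h_mem : (1 - ξ) • u t ∈ Ω :=
      (h.isCore hR₁ hξ hξ1).subset (mul_nonneg hξ hR₁) ⟨_, h.mem t ht, rfl⟩
    have h_shift : ‖(1 - ξ) • u t - u t‖ = ξ * ‖0 - u t‖ := by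
      rw [sub_smul, one_smul, sub_sub_cancel_left, norm_neg, norm_smul, Real.norm_of_nonneg hξ,
        zero_sub, norm_neg]
    calc f t ((1 - ξ) • u t) - f t (u t) ≤ G * (ξ * ‖0 - u t‖) :=
          h_shift ▸ le_of_abs_le ((h.regularLoss t ht).lipschitz _ h_mem _ (h.mem t ht))
      _ ≤ G * (ξ * r) := by
          gcongr
          exact h.norm_sub_le t ht 0 h0
      _ = ξ * (G * r) := by ring
  have h_sum := Finset.sum_le_card_nsmul _ _ _ h_cost
  rw [Nat.card_Icc, Nat.add_sub_cancel, nsmul_eq_mul, Finset.sum_sub_distrib] at h_sum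
  simp only [runRegret, Finset.sum_sub_distrib]
  linarith

theorem metaLoss_eq_runRegret_add (Ω : Set (E d)) (R₁ η : ℝ) (T : ℕ) (f : ℕ → E d → ℝ)
    (u : ℕ → E d) (j : ℕ → Fin d) :
    metaLoss Ω R₁ η T f j
      = runRegret ((1 - 1 / (T : ℝ)) • Ω) (1 / T * R₁) η f u j T
        + ∑ t ∈ Finset.Icc 1 T, f t (u t) := by
  rw [runRegret, Finset.sum_sub_distrib, sub_add_cancel]
  rfl

variable {P : Type*} [MeasurableSpace P] {μ : Measure P} [IsProbabilityMeasure μ]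
  {i : ℕ → P → Fin d}

theorem integral_metaLoss_sub_eq (Ω : Set (E d)) (R₁ η : ℝ) (T : ℕ) (f : ℕ → E d → ℝ)
    (u : ℕ → E d) (hi : ∀ t, Measurable (i t)) :
    ∫ ω, metaLoss Ω R₁ η T f (fun t => i t ω) ∂μ - ∑ t ∈ Finset.Icc 1 T, f t (u t)
      = ∫ ω, runRegret ((1 - 1 / (T : ℝ)) • Ω) (1 / T * R₁) η f u (fun t => i t ω) T ∂μ := by
  simp only [metaLoss_eq_runRegret_add Ω R₁ η T f u]
  rw [integral_add (integrable_of_dependsOn hi (dependsOn_runRegret _ _ _ _ _ _))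
    (integrable_const _), integral_const, probReal_univ, one_smul, add_sub_cancel_right]

theorem TrackingProblem.integral_metaLoss_sub_le_mul (h : TrackingProblem L G r R₁ T Ω f u)
    (hG : 0 ≤ G) (hR₁ : 0 ≤ R₁) (hT : 1 ≤ T) (η : ℝ) (hi : ∀ t, Measurable (i t)) :
    ∫ ω, metaLoss Ω R₁ η T f (fun t => i t ω) ∂μ - ∑ t ∈ Finset.Icc 1 T, f t (u t)
      ≤ T * (G * r) + G * R₁ := by
  have hT1 : (1 : ℝ) ≤ T := by exact_mod_cast hT
  have hξ : 0 ≤ 1 / (T : ℝ) := by positivity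
  have hξ1 : 1 / (T : ℝ) ≤ 1 := (div_le_one (by linarith)).2 hT1
  have hK := h.isCore hR₁ hξ hξ1
  have hδ : 0 ≤ 1 / (T : ℝ) * R₁ := mul_nonneg hξ hR₁
  rw [integral_metaLoss_sub_eq Ω R₁ η T f u hi]
  calc _ ≤ ∫ _, T * (G * (r + 1 / T * R₁)) ∂μ :=
        integral_mono (integrable_of_dependsOn hi (dependsOn_runRegret _ _ _ _ _ _))
          (integrable_const _) fun ω => runRegret_le_mul hG hδ hK ⟨0, h.zero_mem hR₁, smul_zero _⟩
            h.regularLoss h.mem (fun t ht w hw => h.norm_sub_le t ht w (hK.subset hδ hw)) η _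
    _ = T * (G * r) + G * R₁ := by
        rw [integral_const, probReal_univ, one_smul]
        field_simp

theorem TrackingProblem.integral_metaLoss_sub_le (h : TrackingProblem L G r R₁ T Ω f u)
    (hL : 0 ≤ L) (hG : 0 ≤ G) (hR₁ : 0 < R₁) (hT : 1 ≤ T) (hη : 0 < η)
    (hηL : 96 * η ^ 2 * (d : ℝ) ^ 3 * L ^ 2 ≤ 1)
    (hq : ∀ t ∈ Finset.Ico 1 T, ∀ w ∈ Ω,
      ‖gradientWithin (f (t + 1)) Ω w - gradientWithin (f t) Ω w‖ ^ 2 ≤ q t)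
    (hi : IsUniformIID μ i) :
    ∫ ω, metaLoss Ω R₁ η T f (fun t => i t ω) ∂μ - ∑ t ∈ Finset.Icc 1 T, f t (u t)
      ≤ (3 / 2 * r ^ 2 + r * ∑ t ∈ Finset.Ico 1 T, ‖u t - u (t + 1)‖) / η
        + 24 * η * d ^ 3 * (∑ t ∈ Finset.Ico 1 T, q t + d * L ^ 2 * R₁ ^ 2 / T)
        + 2 * η * d ^ 3 * G ^ 2 + √d * (L * R₁ / 2) * r + G * (R₁ + 2 * r) := by
  have hT1 : (1 : ℝ) ≤ T := by exact_mod_cast hT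
  have hξ : 0 < 1 / (T : ℝ) := by positivity
  have hξ1 : 1 / (T : ℝ) ≤ 1 := (div_le_one (by linarith)).2 hT1
  have h_mem : 1 ∈ Finset.Icc 1 T := Finset.left_mem_Icc.2 hT
  have hr : 0 ≤ r := (norm_nonneg _).trans (h.norm_sub_le 1 h_mem 0 (h.zero_mem hR₁.le))
  set ξ := 1 / (T : ℝ) with hξT
  have h_path := sum_norm_smul_sub_smul_le (sub_nonneg.2 hξ1) (sub_le_self 1 hξ.le) u
    (Finset.Ico 1 T)
  have h_core := integral_runRegret_le hL hG (mul_pos hξ hR₁) hη hηL (h.isCore hR₁.le hξ.le hξ1)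
    ⟨0, h.zero_mem hR₁.le, smul_zero _⟩ hT h.regularLoss hq (fun t ht => ⟨_, h.mem t ht, rfl⟩)
    (fun t ht w hw => h.norm_sub_smul_le hξ.le hξ1 ht hw) hi
  have h_int := fun v : ℕ → E d => integrable_of_dependsOn (μ := μ) hi.1
    (dependsOn_runRegret ((1 - ξ) • Ω) (ξ * R₁) η f v T)
  rw [integral_metaLoss_sub_eq Ω R₁ η T f u hi.1]
  calc _ ≤ ∫ ω, (runRegret ((1 - ξ) • Ω) (ξ * R₁) η f (fun t => (1 - ξ) • u t)
          (fun t => i t ω) T + T * (ξ * (G * r))) ∂μ :=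
        integral_mono (h_int _) ((h_int _).add (integrable_const _)) fun ω =>
          h.runRegret_le_runRegret_smul_add hG hR₁.le hξ.le hξ1 _ _ _ _
    _ ≤ (3 / 2 * r ^ 2 + r * ∑ t ∈ Finset.Ico 1 T, ‖u t - u (t + 1)‖) / η
        + 24 * η * d ^ 3 * (∑ t ∈ Finset.Ico 1 T, q t + T * (d * L ^ 2 * (ξ * R₁) ^ 2))
        + 2 * η * d ^ 3 * G ^ 2 + T * (G * (ξ * R₁) + √d * (L * (ξ * R₁) / 2) * r) + G * r
        + T * (ξ * (G * r)) := by
        rw [integral_add (h_int _) (integrable_const _), integral_const, probReal_univ, one_smul]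
        gcongr
        refine h_core.trans ?_
        gcongr
    _ = _ := by
        rw [hξT]
        field_simp
        ring

end TrackingProblem

/-! ### Tuning the step size -/

section StepSize

variable {r B S cap : ℝ}

theorem stepSize_le_cap : stepSize d r B S cap ≤ cap := by
  unfold stepSize
  split_ifs
  · exact le_rfl
  · exact min_le_right _ _

theorem stepSize_pos (hd : 0 < d) (hr : 0 < r) (hB : 0 ≤ B) (hS : 0 ≤ S) (hcap : 0 < cap) :
    0 < stepSize d r B S cap := by
  unfold stepSize
  split_ifs with hS0
  · exact hcap
  · have : 0 < S := hS.lt_of_ne' hS0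
    exact lt_min (Real.sqrt_pos.2 (by positivity)) hcap

theorem div_stepSize_le (hd : 0 < d) (hr : 0 < r) (hB : 0 ≤ B) (hS : 0 ≤ S) (hcap : 0 < cap) :
    (2 * r * B + r ^ 2) / stepSize d r B S cap
      ≤ 3 * (d ^ 2 * √(S * (2 * r * B + r ^ 2))) + (2 * r * B + r ^ 2) / cap := by
  have hN : 0 < 2 * r * B + r ^ 2 := by positivity
  unfold stepSize
  set N := 2 * r * B + r ^ 2
  split_ifs with hS0
  · simp [hS0]
  have : 0 < S := hS.lt_of_ne' hS0
  set A := √(N / (8 * S * d ^ 4)) with hA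
  have hA0 : 0 < A := Real.sqrt_pos.2 (by positivity)
  have hA_sq : A ^ 2 * (8 * S * d ^ 4) = N := by
    rw [hA, Real.sq_sqrt (by positivity)]
    field_simp
  have h_sqrt_sq : √(S * N) ^ 2 = S * N := Real.sq_sqrt (by positivity)
  have h_left : N / A ≤ 3 * (d ^ 2 * √(S * N)) := by
    rw [div_le_iff₀ hA0]
    refine (sq_le_sq₀ hN.le (by positivity)).1 ?_
    calc N ^ 2 = 8 * (A ^ 2 * d ^ 4 * (S * N)) := by rw [← hA_sq]; ring
      _ ≤ 9 * (A ^ 2 * d ^ 4 * (S * N)) := by gcongr; norm_num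
      _ = 9 * (A ^ 2 * d ^ 4 * √(S * N) ^ 2) := by rw [h_sqrt_sq]
      _ = (3 * (d ^ 2 * √(S * N)) * A) ^ 2 := by ring
  calc N / min A cap ≤ N / A + N / cap := by
        have := div_pos hN hA0
        have := div_pos hN hcap
        rcases min_choice A cap with h | h <;> rw [h] <;> linarith
    _ ≤ _ := by gcongr

theorem stepSize_mul_le (hd : 0 < d) (hr : 0 < r) (hB : 0 ≤ B) (hS : 0 ≤ S) :
    stepSize d r B S cap * d ^ 2 * S ≤ √(S * (2 * r * B + r ^ 2)) := by
  unfold stepSize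
  split_ifs with hS0
  · simp [hS0]
  have : 0 < S := hS.lt_of_ne' hS0
  set N := 2 * r * B + r ^ 2
  calc min √(N / (8 * S * d ^ 4)) cap * d ^ 2 * S ≤ √(N / (8 * S * d ^ 4)) * d ^ 2 * S := by
        gcongr
        exact min_le_left _ _
    _ = √(S * N / 8) := by
        rw [mul_assoc, ← Real.sqrt_sq (by positivity : (0 : ℝ) ≤ d ^ 2 * S),
          ← Real.sqrt_mul (by positivity)]
        congr 1
        field_simp
    _ ≤ √(S * N) := Real.sqrt_le_sqrt (div_le_self (by positivity) (by norm_num))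

end StepSize

theorem rpow_three_halves_sq {x : ℝ} (hx : 0 ≤ x) : (x ^ (3 / 2 : ℝ)) ^ 2 = x ^ 3 := by
  rw [← Real.rpow_natCast, ← Real.rpow_mul hx, ← Real.rpow_natCast]
  norm_num

theorem self_le_rpow_three_halves {x : ℝ} (hx : 1 ≤ x) : x ≤ x ^ (3 / 2 : ℝ) :=
  Real.self_le_rpow_of_one_le hx (by norm_num)

section Costs

variable {L G r R₁ B S κ η : ℝ}

theorem two_mul_add_sq_le_mul_max (hr : 0 ≤ r) (B : ℝ) :
    2 * r * B + r ^ 2 ≤ (2 * r + r ^ 2) * max B 1 := by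
  rw [add_mul]
  gcongr
  · exact le_max_left B 1
  · exact le_mul_of_one_le_right (by positivity) (le_max_right B 1)

theorem sq_mul_sqrt_le (hr : 0 ≤ r) (hS : 0 ≤ S) (B : ℝ) (D : ℝ) :
    D ^ 2 * √(S * (2 * r * B + r ^ 2)) ≤ √(2 * r + r ^ 2) * (D ^ 2 * √(S * max B 1)) := by
  calc D ^ 2 * √(S * (2 * r * B + r ^ 2))
      ≤ D ^ 2 * √((2 * r + r ^ 2) * (S * max B 1)) := by
        rw [mul_left_comm]
        gcongr
        exact two_mul_add_sq_le_mul_max hr B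
    _ = √(2 * r + r ^ 2) * (D ^ 2 * √(S * max B 1)) := by
        rw [Real.sqrt_mul (by positivity), mul_left_comm]

theorem variation_cost_le (hd : 0 < d) (hL : 0 < L) (hr : 0 < r) (hB : 0 ≤ B) (hS : 0 ≤ S)
    (hκ : 0 < κ) (hη : η = stepSize d r B S (1 / (κ * L * (d : ℝ) ^ (3 / 2 : ℝ)))) :
    (3 / 2 * r ^ 2 + r * B) / η + 24 * η * d ^ 3 * S
      ≤ 30 * √(2 * r + r ^ 2) * (d ^ 2 * √(S * max B 1))
        + 2 * (2 * r + r ^ 2) * L * (κ * (d : ℝ) ^ (3 / 2 : ℝ) * max B 1) := by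
  set D := (d : ℝ) ^ (3 / 2 : ℝ)
  have hd1 : (1 : ℝ) ≤ d := by exact_mod_cast hd
  have : 0 < D := by positivity
  have hη0 : 0 < η := hη ▸ stepSize_pos hd hr hB hS (by positivity)
  have h_div : (2 * r * B + r ^ 2) / η
      ≤ 3 * (d ^ 2 * √(S * (2 * r * B + r ^ 2))) + (2 * r * B + r ^ 2) / (1 / (κ * L * D)) :=
    hη ▸ div_stepSize_le hd hr hB hS (by positivity)
  have h_mul : η * d ^ 2 * S ≤ √(S * (2 * r * B + r ^ 2)) := hη ▸ stepSize_mul_le hd hr hB hS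
  have h_root := sq_mul_sqrt_le hr.le hS B d
  have h_cap : (2 * r * B + r ^ 2) / (1 / (κ * L * D))
      ≤ (2 * r + r ^ 2) * max B 1 * (κ * L * D) := by
    rw [div_div_eq_mul_div, div_one]
    gcongr
    exact two_mul_add_sq_le_mul_max hr.le B
  have h_path : (3 / 2 * r ^ 2 + r * B) / η ≤ 3 / 2 * ((2 * r * B + r ^ 2) / η) := by
    rw [← mul_div_assoc]
    gcongr
    linarith [mul_nonneg hr.le hB]
  have h_gradient : η * d ^ 3 * S ≤ d ^ 2 * √(S * (2 * r * B + r ^ 2)) := by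
    calc η * d ^ 3 * S = d * (η * d ^ 2 * S) := by ring
      _ ≤ d ^ 2 * √(S * (2 * r * B + r ^ 2)) := by
        gcongr
        exact le_self_pow₀ hd1 two_ne_zero
  have h_slack : 0 ≤ √(2 * r + r ^ 2) * (d ^ 2 * √(S * max B 1)) := by positivity
  have h_slack' : 0 ≤ (2 * r + r ^ 2) * max B 1 * (κ * L * D) := by positivity
  linarith

theorem mul_pow_three_le_of_mul_le (hd : 0 < d) (hL : 0 < L)
    (hη : η * (L * (d : ℝ) ^ (3 / 2 : ℝ)) ≤ 1 / 16) :
    η * d ^ 3 ≤ (d : ℝ) ^ (3 / 2 : ℝ) / (16 * L) := by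
  rw [← rpow_three_halves_sq (Nat.cast_nonneg d), le_div_iff₀ (by positivity)]
  have hD : 0 < (d : ℝ) ^ (3 / 2 : ℝ) := by positivity
  linarith [mul_le_mul_of_nonneg_left hη hD.le]

theorem ninety_six_mul_sq_le_one (hη0 : 0 ≤ η) (hL : 0 ≤ L)
    (hη : η * (L * (d : ℝ) ^ (3 / 2 : ℝ)) ≤ 1 / 16) : 96 * η ^ 2 * (d : ℝ) ^ 3 * L ^ 2 ≤ 1 := by
  calc 96 * η ^ 2 * (d : ℝ) ^ 3 * L ^ 2 = 96 * (η * (L * (d : ℝ) ^ (3 / 2 : ℝ))) ^ 2 := by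
        rw [← rpow_three_halves_sq (Nat.cast_nonneg d)]
        ring
    _ ≤ 96 * (1 / 16) ^ 2 := by gcongr
    _ ≤ 1 := by norm_num

theorem smoothness_cost_le (hd : 0 < d) (hL : 0 < L) (hr : 0 ≤ r) (hR₁ : 0 ≤ R₁)
    (hη : η * (L * (d : ℝ) ^ (3 / 2 : ℝ)) ≤ 1 / 16) {T : ℕ} (hT : d ≤ T) :
    24 * η * d ^ 3 * (d * L ^ 2 * R₁ ^ 2 / T) + 2 * η * d ^ 3 * G ^ 2 + √d * (L * R₁ / 2) * r
      ≤ (2 * L * R₁ ^ 2 + G ^ 2 / L + L * R₁ * r) * (d : ℝ) ^ (3 / 2 : ℝ) := by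
  have h_cube := mul_pow_three_le_of_mul_le hd hL hη
  have hd1 : (1 : ℝ) ≤ d := by exact_mod_cast hd
  have h_self := self_le_rpow_three_halves hd1
  set D := (d : ℝ) ^ (3 / 2 : ℝ)
  have hT0 : (0 : ℝ) < T := by exact_mod_cast hd.trans_le hT
  have h_ratio : (d : ℝ) / T ≤ 1 := (div_le_one hT0).2 (by exact_mod_cast hT)
  have h_sqrt : √d ≤ D := (Real.sqrt_le_self_iff.2 (.inr hd1)).trans h_self
  calc _ = 24 * (η * d ^ 3) * (L ^ 2 * R₁ ^ 2 * (d / T)) + 2 * (η * d ^ 3) * G ^ 2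
        + √d * (L * R₁ / 2) * r := by ring
    _ ≤ 24 * (D / (16 * L)) * (L ^ 2 * R₁ ^ 2 * 1) + 2 * (D / (16 * L)) * G ^ 2
        + D * (L * R₁ / 2) * r := by gcongr
    _ = (3 / 2 * (L * R₁ ^ 2) + 1 / 8 * (G ^ 2 / L) + 1 / 2 * (L * R₁ * r)) * D := by
        field_simp
        ring
    _ ≤ (2 * (L * R₁ ^ 2) + 1 * (G ^ 2 / L) + 1 * (L * R₁ * r)) * D := by gcongr <;> norm_num
    _ = _ := by ring

end Costs

/-- Comparator path length and squared gradient variation over the rounds `1, …, T` are at most `B`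
and `S`. Only differences between consecutive rounds within the horizon count, so no loss before
round `1` is involved. -/
structure VariationBudget (B S : ℝ) (T : ℕ) (Ω : Set (E d)) (f : ℕ → E d → ℝ)
    (u : ℕ → E d) : Prop where
  path_le : ∑ t ∈ Finset.Ico 1 T, ‖u t - u (t + 1)‖ ≤ B
  gradient_le : ∃ q : ℕ → ℝ, (∀ t ∈ Finset.Ico 1 T, ∀ w ∈ Ω,
    ‖gradientWithin (f (t + 1)) Ω w - gradientWithin (f t) Ω w‖ ^ 2 ≤ q t) ∧
      ∑ t ∈ Finset.Ico 1 T, q t ≤ S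

/-- The constant of the regret bound for step sizes capped at `1 / (κ * L * d ^ (3 / 2))` with
`16 ≤ κ`. -/
noncomputable def regretConst (L G r R₁ : ℝ) : ℝ :=
  30 * √(2 * r + r ^ 2) + 2 * (2 * r + r ^ 2) * L + (2 * L * R₁ ^ 2 + G ^ 2 / L + L * R₁ * r)
    + G * (R₁ + 2 * r)

section Tuned

variable {L G r R₁ B S κ : ℝ} {T : ℕ} {Ω : Set (E d)} {f : ℕ → E d → ℝ} {u : ℕ → E d}

theorem VariationBudget.path_nonneg (hv : VariationBudget B S T Ω f u) : 0 ≤ B :=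
  (Finset.sum_nonneg fun _ _ => norm_nonneg _).trans hv.path_le

theorem VariationBudget.gradient_nonneg (hv : VariationBudget B S T Ω f u) (hΩ : Ω.Nonempty) :
    0 ≤ S := by
  obtain ⟨q, hq, hqS⟩ := hv.gradient_le
  obtain ⟨w, hw⟩ := hΩ
  exact (Finset.sum_nonneg fun t ht => (sq_nonneg _).trans (hq t ht w hw)).trans hqS

theorem TrackingProblem.mono {G' : ℝ} (h : TrackingProblem L G r R₁ T Ω f u) (hG : G ≤ G') :
    TrackingProblem L G' r R₁ T Ω f u where
  __ := h
  regularLoss t ht :=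
    { h.regularLoss t ht with
      lipschitz := fun w hw w' hw' =>
        ((h.regularLoss t ht).lipschitz w hw w' hw').trans (by gcongr) }

theorem regretConst_pos (hL : 0 < L) (hG : 0 ≤ G) (hr : 0 < r) (hR₁ : 0 ≤ R₁) :
    0 < regretConst L G r R₁ := by
  unfold regretConst
  positivity

theorem costs_le_regretConst_mul (hL : 0 < L) (hG : 0 ≤ G) (hr : 0 ≤ r) (hR₁ : 0 ≤ R₁)
    {Q Z D X : ℝ} (hQ : Q ≤ X) (hZ : Z ≤ X) (hD : D ≤ X) (hX : 1 ≤ X) :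
    30 * √(2 * r + r ^ 2) * Q + 2 * (2 * r + r ^ 2) * L * Z
        + (2 * L * R₁ ^ 2 + G ^ 2 / L + L * R₁ * r) * D + G * (R₁ + 2 * r)
      ≤ regretConst L G r R₁ * X := by
  have h_const : G * (R₁ + 2 * r) ≤ G * (R₁ + 2 * r) * X :=
    le_mul_of_one_le_right (by positivity) hX
  calc _ ≤ 30 * √(2 * r + r ^ 2) * X + 2 * (2 * r + r ^ 2) * L * X
        + (2 * L * R₁ ^ 2 + G ^ 2 / L + L * R₁ * r) * X + G * (R₁ + 2 * r) * X := by gcongr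
    _ = regretConst L G r R₁ * X := by
        rw [regretConst]
        ring

variable {P : Type*} [MeasurableSpace P] {μ : Measure P} [IsProbabilityMeasure μ]
  {i : ℕ → P → Fin d}

theorem TrackingProblem.integral_metaLoss_sub_le_costs (h : TrackingProblem L G r R₁ T Ω f u)
    (hv : VariationBudget B S T Ω f u) (hL : 0 < L) (hG : 0 ≤ G) (hr : 0 < r) (hR₁ : 0 < R₁)
    (hd : 0 < d) (hdT : d ≤ T) (hκ : 16 ≤ κ) (hi : IsUniformIID μ i) :
    ∫ ω, metaLoss Ω R₁ (stepSize d r B S (1 / (κ * L * (d : ℝ) ^ (3 / 2 : ℝ)))) T f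
          (fun t => i t ω) ∂μ - ∑ t ∈ Finset.Icc 1 T, f t (u t)
      ≤ 30 * √(2 * r + r ^ 2) * (d ^ 2 * √(S * max B 1))
        + 2 * (2 * r + r ^ 2) * L * (κ * (d : ℝ) ^ (3 / 2 : ℝ) * max B 1)
        + (2 * L * R₁ ^ 2 + G ^ 2 / L + L * R₁ * r) * (d : ℝ) ^ (3 / 2 : ℝ)
        + G * (R₁ + 2 * r) := by
  have hB := hv.path_nonneg
  have hS := hv.gradient_nonneg ⟨0, h.zero_mem hR₁.le⟩
  have hκ0 : 0 < κ := by linarith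
  set η := stepSize d r B S (1 / (κ * L * (d : ℝ) ^ (3 / 2 : ℝ))) with hη
  have hη0 : 0 < η := stepSize_pos hd hr hB hS (by positivity)
  have h_cap : η * (L * (d : ℝ) ^ (3 / 2 : ℝ)) ≤ 1 / 16 := by
    calc η * (L * (d : ℝ) ^ (3 / 2 : ℝ))
        ≤ 1 / (κ * L * (d : ℝ) ^ (3 / 2 : ℝ)) * (L * (d : ℝ) ^ (3 / 2 : ℝ)) := by
          gcongr
          exact stepSize_le_cap
      _ = 1 / κ := by field_simp
      _ ≤ 1 / 16 := by gcongr
  obtain ⟨q, hq, hqS⟩ := hv.gradient_le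
  have h_regret := h.integral_metaLoss_sub_le hL.le hG hR₁ (hd.trans_le hdT) hη0
    (ninety_six_mul_sq_le_one hη0.le hL.le h_cap) hq hi
  have h_path : (3 / 2 * r ^ 2 + r * ∑ t ∈ Finset.Ico 1 T, ‖u t - u (t + 1)‖) / η
      ≤ (3 / 2 * r ^ 2 + r * B) / η := by
    gcongr
    exact hv.path_le
  have h_gradient : 24 * η * d ^ 3 * ∑ t ∈ Finset.Ico 1 T, q t ≤ 24 * η * d ^ 3 * S := by gcongr
  have h_variation := variation_cost_le hd hL hr hB hS hκ0 hη
  have h_smooth := smoothness_cost_le (G := G) hd hL hr.le hR₁.le h_cap hdT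
  linarith

theorem TrackingProblem.integral_metaLoss_sub_le_regretConst_mul
    (h : TrackingProblem L G r R₁ T Ω f u) (hv : VariationBudget B S T Ω f u) (hL : 0 < L)
    (hG : 0 ≤ G) (hr : 0 < r) (hR₁ : 0 < R₁) (hd : 0 < d) (hT : 1 ≤ T) (hκ : 16 ≤ κ)
    (hi : IsUniformIID μ i) :
    ∫ ω, metaLoss Ω R₁ (stepSize d r B S (1 / (κ * L * (d : ℝ) ^ (3 / 2 : ℝ)))) T f
          (fun t => i t ω) ∂μ - ∑ t ∈ Finset.Icc 1 T, f t (u t)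
      ≤ regretConst L G r R₁
        * max (d ^ 2 * √(S * max B 1)) (κ * (d : ℝ) ^ (3 / 2 : ℝ) * max B 1) := by
  have hd1 : (1 : ℝ) ≤ d := by exact_mod_cast hd
  have hdD := self_le_rpow_three_halves hd1
  have h_costs := fun hdT => h.integral_metaLoss_sub_le_costs hv hL hG hr hR₁ hd hdT hκ hi
  set D := (d : ℝ) ^ (3 / 2 : ℝ)
  set Q := (d : ℝ) ^ 2 * √(S * max B 1)
  have hDZ : D ≤ κ * D * max B 1 :=
    calc D = 1 * D * 1 := by ring
      _ ≤ κ * D * max B 1 := by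
        gcongr
        · linarith
        · exact le_max_right B 1
  set Z := κ * D * max B 1
  have hZ : Z ≤ max Q Z := le_max_right Q Z
  have hD : D ≤ max Q Z := hDZ.trans hZ
  rcases le_or_gt d T with hdT | hTd
  · exact (h_costs hdT).trans (costs_le_regretConst_mul hL hG hr.le hR₁.le (le_max_left Q Z) hZ hD
      ((hd1.trans hdD).trans hD))
  · have hTD : (T : ℝ) ≤ D := (Nat.cast_le.2 hTd.le).trans hdD
    calc _ ≤ T * (G * r) + 1 * (G * R₁) :=
          (h.integral_metaLoss_sub_le_mul hG hR₁.le hT _ hi.1).trans_eq (by rw [one_mul])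
      _ ≤ D * (G * (2 * r)) + D * (G * R₁) := by
          gcongr
          · linarith
          · linarith
      _ = G * (R₁ + 2 * r) * D := by ring
      _ ≤ regretConst L G r R₁ * max Q Z := by
          have h_const : G * (R₁ + 2 * r) ≤ regretConst L G r R₁ :=
            le_add_of_nonneg_left (by positivity)
          gcongr
          exact (regretConst_pos hL hG hr hR₁.le).le

end Tuned

theorem one_half_le_sqrt_log {x : ℝ} (hx : 2 ≤ x) : 1 / 2 ≤ √(Real.log x) := by
  refine Real.le_sqrt_of_sq_le ?_
  linarith [Real.log_two_gt_d9, Real.log_le_log two_pos hx]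

theorem le_exp_sq_of_sqrt_log_le {x c : ℝ} (hx : 1 ≤ x) (h : √(Real.log x) ≤ c) :
    x ≤ Real.exp (c ^ 2) := by
  have hc : 0 ≤ c := (Real.sqrt_nonneg _).trans h
  rw [← Real.log_le_iff_le_exp (by linarith)]
  exact (Real.sqrt_le_left hc).1 h

/-- The constant valid for both step sizes. The second summand is the loss over a horizon of at most
`exp 16` rounds, where the cap `1 / (4 * L * d ^ (3 / 2) * √(log T))` may exceed the smoothness
threshold `1 / (16 * L * d ^ (3 / 2))`. -/
noncomputable def trackingConst (L G r R₁ : ℝ) : ℝ :=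
  16 * regretConst L G r R₁ + 2 * (Real.exp 16 * (G * (r + R₁)))

section Tracking

variable {L G r R₁ B S : ℝ} {T : ℕ} {Ω : Set (E d)} {f : ℕ → E d → ℝ} {u : ℕ → E d}

theorem trackingConst_pos (hL : 0 < L) (hG : 0 ≤ G) (hr : 0 < r) (hR₁ : 0 ≤ R₁) :
    0 < trackingConst L G r R₁ := by
  have h := regretConst_pos hL hG hr hR₁
  unfold trackingConst
  positivity

theorem regretConst_mul_max_le (hL : 0 < L) (hG : 0 ≤ G) (hr : 0 < r) (hR₁ : 0 ≤ R₁) {c x : ℝ}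
    (hc : 1 ≤ c) (hc16 : c ≤ 16) (hx : 0 ≤ x) (y : ℝ) :
    regretConst L G r R₁ * max x (c * y) ≤ trackingConst L G r R₁ * max x y := by
  have hC := (regretConst_pos hL hG hr hR₁).le
  have : 0 ≤ max x y := hx.trans (le_max_left x y)
  calc regretConst L G r R₁ * max x (c * y) ≤ regretConst L G r R₁ * (c * max x y) := by
        rw [mul_max_of_nonneg x y (by linarith)]
        gcongr
        exact le_mul_of_one_le_left hx hc
    _ ≤ regretConst L G r R₁ * (16 * max x y) := by gcongr
    _ = 16 * regretConst L G r R₁ * max x y := by ring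
    _ ≤ trackingConst L G r R₁ * max x y := by
        have h_const : 16 * regretConst L G r R₁ ≤ trackingConst L G r R₁ :=
          le_add_of_nonneg_right (by positivity)
        gcongr

theorem exp_mul_le_trackingConst_mul (hL : 0 < L) (hG : 0 ≤ G) (hr : 0 < r) (hR₁ : 0 ≤ R₁) {x : ℝ}
    (hx : 1 / 2 ≤ x) : Real.exp 16 * (G * (r + R₁)) ≤ trackingConst L G r R₁ * x := by
  have hC := (regretConst_pos hL hG hr hR₁).le
  calc Real.exp 16 * (G * (r + R₁)) = 2 * (Real.exp 16 * (G * (r + R₁))) * (1 / 2) := by ring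
    _ ≤ trackingConst L G r R₁ * x := by
        have h_const : 2 * (Real.exp 16 * (G * (r + R₁))) ≤ trackingConst L G r R₁ :=
          le_add_of_nonneg_left (by positivity)
        gcongr
        exact (trackingConst_pos hL hG hr hR₁).le

variable {P : Type*} [MeasurableSpace P] {μ : Measure P} [IsProbabilityMeasure μ]
  {i : ℕ → P → Fin d}

theorem TrackingProblem.integral_metaLoss_sub_le_trackingConst_mul
    (h : TrackingProblem L G r R₁ T Ω f u) (hv : VariationBudget B S T Ω f u) (hL : 0 < L)
    (hG : 0 ≤ G) (hr : 0 < r) (hR₁ : 0 < R₁) (hd : 0 < d) (hT : 1 ≤ T) (hi : IsUniformIID μ i) :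
    ∫ ω, metaLoss Ω R₁ (stepSize d r B S (1 / (16 * L * (d : ℝ) ^ (3 / 2 : ℝ)))) T f
          (fun t => i t ω) ∂μ - ∑ t ∈ Finset.Icc 1 T, f t (u t)
      ≤ trackingConst L G r R₁
        * max (d ^ 2 * √(S * max B 1)) ((d : ℝ) ^ (3 / 2 : ℝ) * max B 1) := by
  refine (h.integral_metaLoss_sub_le_regretConst_mul hv hL hG hr hR₁ hd hT le_rfl hi).trans ?_
  rw [mul_assoc 16]
  exact regretConst_mul_max_le hL hG hr hR₁.le (by norm_num) le_rfl (by positivity) _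

theorem TrackingProblem.integral_metaLoss_sub_le_trackingConst_mul_sqrt_log
    (h : TrackingProblem L G r R₁ T Ω f u) (hv : VariationBudget B S T Ω f u) (hL : 0 < L)
    (hG : 0 ≤ G) (hr : 0 < r) (hR₁ : 0 < R₁) (hd : 0 < d) (hT : 2 ≤ T) (hi : IsUniformIID μ i) :
    ∫ ω, metaLoss Ω R₁
          (stepSize d r B S (1 / (4 * L * (d : ℝ) ^ (3 / 2 : ℝ) * √(Real.log T)))) T f
          (fun t => i t ω) ∂μ - ∑ t ∈ Finset.Icc 1 T, f t (u t)
      ≤ trackingConst L G r R₁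
        * max (d ^ 2 * √(S * max B 1)) ((d : ℝ) ^ (3 / 2 : ℝ) * √(Real.log T) * max B 1) := by
  have hT1 : 1 ≤ T := by omega
  have hT1' : (1 : ℝ) ≤ T := by exact_mod_cast hT1
  rcases le_or_gt 4 √(Real.log T) with h_long | h_short
  · rw [show 4 * L * (d : ℝ) ^ (3 / 2 : ℝ) * √(Real.log T)
      = 4 * √(Real.log T) * L * (d : ℝ) ^ (3 / 2 : ℝ) by ring]
    refine (h.integral_metaLoss_sub_le_regretConst_mul hv hL hG hr hR₁ hd hT1
      (by linarith) hi).trans ?_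
    rw [show 4 * √(Real.log T) * (d : ℝ) ^ (3 / 2 : ℝ) * max B 1
      = 4 * ((d : ℝ) ^ (3 / 2 : ℝ) * √(Real.log T) * max B 1) by ring]
    exact regretConst_mul_max_le hL hG hr hR₁.le (by norm_num) (by norm_num) (by positivity) _
  · have h_horizon : (T : ℝ) ≤ Real.exp 16 := by
      have h_exp := le_exp_sq_of_sqrt_log_le hT1' h_short.le
      norm_num at h_exp
      exact h_exp
    have h_half : 1 / 2 ≤ (d : ℝ) ^ (3 / 2 : ℝ) * √(Real.log T) * max B 1 :=
      calc (1 / 2 : ℝ) = 1 * (1 / 2) * 1 := by ring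
        _ ≤ (d : ℝ) ^ (3 / 2 : ℝ) * √(Real.log T) * max B 1 := by
          gcongr
          · exact Real.one_le_rpow (by exact_mod_cast hd) (by norm_num)
          · exact one_half_le_sqrt_log (by exact_mod_cast hT)
          · exact le_max_right B 1
    calc _ ≤ T * (G * r) + 1 * (G * R₁) :=
          (h.integral_metaLoss_sub_le_mul hG hR₁.le hT1 _ hi.1).trans_eq (by rw [one_mul])
      _ ≤ Real.exp 16 * (G * r) + Real.exp 16 * (G * R₁) := by
          gcongr
          exact hT1'.trans h_horizon
      _ = Real.exp 16 * (G * (r + R₁)) := by ring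
      _ ≤ _ := exp_mul_le_trackingConst_mul hL hG hr hR₁.le (h_half.trans (le_max_right _ _))

end Tracking

/-! ### Variations of minimizers -/

section Minimizers

variable {T : ℕ} {Ω : Set (E d)} {f : ℕ → E d → ℝ} {u : ℕ → E d}

theorem sum_norm_sub_le_of_pathVariation_le {B : ℝ≥0} (hB : pathVariation Ω f T ≤ B)
    (hu : ∀ t ∈ Finset.Icc 1 T, u t ∈ minimizers Ω (f t)) :
    ∑ t ∈ Finset.Ico 1 T, ‖u t - u (t + 1)‖ ≤ B := by
  have h_path : ∑ t ∈ Finset.Ico 1 T, ‖u t - u (t + 1)‖ₑ ≤ pathVariation Ω f T :=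
    le_iSup₂ (f := fun (w : ℕ → E d) (_ : ∀ t ∈ Finset.Icc 1 T, w t ∈ minimizers Ω (f t)) =>
      ∑ t ∈ Finset.Ico 1 T, ‖w t - w (t + 1)‖ₑ) u hu
  have h := ENNReal.toReal_mono ENNReal.coe_ne_top (h_path.trans hB)
  rw [ENNReal.toReal_sum fun _ _ => enorm_ne_top] at h
  simpa only [toReal_enorm, ENNReal.coe_toReal] using h

theorem exists_sum_le_of_gradientVariation_le {S : ℝ≥0} (hS : gradientVariation Ω f T ≤ S) :
    ∃ q : ℕ → ℝ, (∀ t ∈ Finset.Ico 1 T, ∀ w ∈ Ω,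
      ‖gradientWithin (f (t + 1)) Ω w - gradientWithin (f t) Ω w‖ ^ 2 ≤ q t) ∧
        ∑ t ∈ Finset.Ico 1 T, q t ≤ S := by
  set b : ℕ → ℝ≥0∞ := fun t =>
    ⨆ w ∈ Ω, ‖gradientWithin (f t) Ω w - gradientWithin (f (t - 1)) Ω w‖ₑ ^ 2
  have h_sum : ∑ t ∈ Finset.Ico 1 T, b (t + 1) ≤ S :=
    calc ∑ t ∈ Finset.Ico 1 T, b (t + 1) = ∑ t ∈ Finset.Ico (1 + 1) (T + 1), b t :=
          Finset.sum_Ico_add' b 1 T 1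
      _ ≤ ∑ t ∈ Finset.Icc 1 T, b t :=
          Finset.sum_le_sum_of_subset fun t => by
            simp only [Finset.mem_Ico, Finset.mem_Icc]
            omega
      _ ≤ S := hS
  have h_finite : ∀ t ∈ Finset.Ico 1 T, b (t + 1) ≠ ⊤ :=
    ENNReal.sum_ne_top.1 (h_sum.trans_lt ENNReal.coe_lt_top).ne
  refine ⟨fun t => (b (t + 1)).toReal, fun t ht w hw => ?_, ?_⟩
  · have h_le : ‖gradientWithin (f (t + 1)) Ω w - gradientWithin (f t) Ω w‖ₑ ^ 2 ≤ b (t + 1) :=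
      le_iSup₂ (f := fun w (_ : w ∈ Ω) =>
        ‖gradientWithin (f (t + 1)) Ω w - gradientWithin (f (t + 1 - 1)) Ω w‖ₑ ^ 2) w hw
    simpa only [ENNReal.toReal_pow, toReal_enorm] using ENNReal.toReal_mono (h_finite t ht) h_le
  · rw [← ENNReal.toReal_sum h_finite]
    exact ENNReal.toReal_mono ENNReal.coe_ne_top h_sum

theorem VariationBudget.of_minimizers {B S : ℝ≥0} (hB : pathVariation Ω f T ≤ B)
    (hS : gradientVariation Ω f T ≤ S) (hu : ∀ t ∈ Finset.Icc 1 T, u t ∈ minimizers Ω (f t)) :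
    VariationBudget B S T Ω f u :=
  ⟨sum_norm_sub_le_of_pathVariation_le hB hu, exists_sum_le_of_gradientVariation_le hS⟩

end Minimizers

end BanditOCO

theorem mainTheorem5_general (L G r R₁ : ℝ) (hL : 0 < L) (hr : 0 < r) (hR₁ : 0 < R₁) :
    ∃ C : ℝ, 0 < C ∧
      ∀ (d : ℕ) (_ : 1 ≤ d) (T : ℕ) (_ : 2 ≤ T) (B S : ℝ) (Ω : Set (BanditOCO.E d))
        (f : ℕ → BanditOCO.E d → ℝ) (u : ℕ → BanditOCO.E d)
        (_ : BanditOCO.TrackingProblem L G r R₁ T Ω f u)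
        (_ : BanditOCO.VariationBudget B S T Ω f u)
        (P : Type*) (_ : MeasurableSpace P) (μ : Measure P) (_ : IsProbabilityMeasure μ)
        (i : ℕ → P → Fin d) (_ : BanditOCO.IsUniformIID μ i),
        ((∫ ω, BanditOCO.metaLoss Ω R₁
              (BanditOCO.stepSize d r B S (1 / (16 * L * (d : ℝ) ^ (3 / 2 : ℝ))))
              T f (fun t => i t ω) ∂μ)
            - ∑ t ∈ Finset.Icc 1 T, f t (u t)
          ≤ C * max ((d : ℝ) ^ 2 * √(S * max B 1)) ((d : ℝ) ^ (3 / 2 : ℝ) * max B 1)) ∧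
        ((∫ ω, BanditOCO.metaLoss Ω R₁
              (BanditOCO.stepSize d r B S
                (1 / (4 * L * (d : ℝ) ^ (3 / 2 : ℝ) * √(Real.log T))))
              T f (fun t => i t ω) ∂μ)
            - ∑ t ∈ Finset.Icc 1 T, f t (u t)
          ≤ C * max ((d : ℝ) ^ 2 * √(S * max B 1))
              ((d : ℝ) ^ (3 / 2 : ℝ) * √(Real.log T) * max B 1)) := by
  refine ⟨BanditOCO.trackingConst L |G| r R₁,
    BanditOCO.trackingConst_pos hL (abs_nonneg G) hr hR₁.le, ?_⟩
  intro d hd T hT B S Ω f u h hv P _ μ _ i hi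
  have h' := h.mono (le_abs_self G)
  exact ⟨h'.integral_metaLoss_sub_le_trackingConst_mul hv hL (abs_nonneg G) hr hR₁ hd (by omega) hi,
    h'.integral_metaLoss_sub_le_trackingConst_mul_sqrt_log hv hL (abs_nonneg G) hr hR₁ hd hT hi⟩

theorem mainTheorem5 (L G r R₁ R₂ : ℝ) (hL : 0 < L) (hr : 0 < r) (hR₁ : 0 < R₁) :
    ∃ C : ℝ, 0 < C ∧
      ∀ (d : ℕ) (_ : 1 ≤ d) (T : ℕ) (_ : 2 ≤ T) (B S : ℝ≥0)
        (Ω : Set (BanditOCO.E d)) (_ : IsClosed Ω) (_ : Convex ℝ Ω)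
        (_ : Metric.closedBall 0 R₁ ⊆ Ω) (_ : Ω ⊆ Metric.closedBall 0 R₂)
        (f : ℕ → BanditOCO.E d → ℝ) (_ : DifferentiableOn ℝ (f 0) Ω)
        (_ : ∀ t ∈ Finset.Icc 1 T, ConvexOn ℝ Ω (f t))
        (_ : ∀ t ∈ Finset.Icc 1 T, ∀ w ∈ Ω, ∀ w' ∈ Ω, |f t w - f t w'| ≤ G * ‖w - w'‖)
        (_ : ∀ t ∈ Finset.Icc 1 T, BanditOCO.SmoothOn L Ω (f t))
        (_ : ∀ t ∈ Finset.Icc 1 T, ∀ w' ∈ BanditOCO.minimizers Ω (f t), ∀ w ∈ Ω, ‖w - w'‖ ≤ r)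
        (_ : BanditOCO.pathVariation Ω f T ≤ (B : ℝ≥0∞))
        (_ : BanditOCO.gradientVariation Ω f T ≤ (S : ℝ≥0∞))
        (wStar : ℕ → BanditOCO.E d)
        (_ : ∀ t ∈ Finset.Icc 1 T, wStar t ∈ BanditOCO.minimizers Ω (f t))
        (P : Type*) (_ : MeasurableSpace P) (μ : Measure P) (_ : IsProbabilityMeasure μ)
        (i : ℕ → P → Fin d) (_ : BanditOCO.IsUniformIID μ i),
        -- step size without the factor `√(ln T)`: the bound without that factor
        ((∫ ω, BanditOCO.metaLoss Ω R₁
              (BanditOCO.stepSize d r B S (1 / (16 * L * (d : ℝ) ^ (3 / 2 : ℝ))))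
              T f (fun t => i t ω) ∂μ)
            - ∑ t ∈ Finset.Icc 1 T, f t (wStar t)
          ≤ C * max ((d : ℝ) ^ 2 * Real.sqrt (S * max (B : ℝ) 1))
              ((d : ℝ) ^ (3 / 2 : ℝ) * max (B : ℝ) 1)) ∧
        -- step size with the factor `√(ln T)`: the bound with that factor
        ((∫ ω, BanditOCO.metaLoss Ω R₁
              (BanditOCO.stepSize d r B S
                (1 / (4 * L * (d : ℝ) ^ (3 / 2 : ℝ) * Real.sqrt (Real.log T))))
              T f (fun t => i t ω) ∂μ)
            - ∑ t ∈ Finset.Icc 1 T, f t (wStar t)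
          ≤ C * max ((d : ℝ) ^ 2 * Real.sqrt (S * max (B : ℝ) 1))
              ((d : ℝ) ^ (3 / 2 : ℝ) * Real.sqrt (Real.log T) * max (B : ℝ) 1)) := by
  obtain ⟨C, hC, h⟩ := mainTheorem5_general L G r R₁ hL hr hR₁
  refine ⟨C, hC, ?_⟩
  intro d hd T hT B S Ω hΩ hΩc hball _ f _ hconv hlip hsmooth hdist hB hS wStar hw
  exact h d hd T hT B S Ω f wStar
    { isClosed := hΩ
      convex := hΩc
      closedBall_subset := hball
      regularLoss := fun t ht => ⟨hconv t ht, hlip t ht, hsmooth t ht⟩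
      mem := fun t ht => (hw t ht).1
      norm_sub_le := fun t ht => hdist t ht _ (hw t ht) }
    (.of_minimizers hB hS hw)
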